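/- **Machines.** A *program* is a table that gives, for ordinal states $s$, a register set to be read and, for each symbol $0,1$, at most one action and next state $t$, where $t$ is not separated from $s$ by a limit ordinal. The register sets are input sets $I_\beta$ (read-only), working sets $W_\beta$ and output sets $O_\beta$ (write-only); each is a tape of registers $R_\alpha$, holding $0$ or $1$, with one current register. Actions: do nothing; write $0$ or $1$ to the current register of a working or output set; move the current register of a set one place left or right where possible; reset it to $R_0$. A computation starts in state $0$ with current registers $R_0$ and all non-input registers $0$; at limit steps the state, the current registers and the contents are the $\limsup$ of their earlier values; it stops when no instruction applies, and at the latest at the step bound. Write $o(\mathfrak c)$ for the least ordinal of cardinality $\mathfrak c$. The length of a program is the number of states in its table. For cardinals $\mathfrak p\le\mathfrak s\le N$, a *parallel $\langle N,\mathfrak p,\mathfrak s\rangle$-hypercomputer* consists of $N$ serial machines, indexed by $\gamma<o(N)$, with at most $N$ register sets of each kind and registers $R_\alpha$, $\alpha<o(N)$, in each set. First the machines, in parallel and from empty registers, run loading programs $P_\gamma$ of length $\le\mathfrak p$ for at most $o(\mathfrak s)$ steps; the outputs become the input registers. Then finitely many stages are chained. In each stage all machines run programs of length $\le\mathfrak p$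 in parallel on their own input registers for at most $o(\mathfrak s)$ steps; a management program then initialises each register of a new input set of each machine $\gamma$ with a bit $b$ and overwrites it by $1-b$ if, for some $\delta$ in a set of machines associated with $\gamma$, the corresponding register of the output set $O_0$ of $\delta$ is $1-b$ (copying is the case of the single machine $\gamma$). Earlier inputs remain available. **Propositions.** Let $\aleph$ be an infinite cardinal. The sets that require $\le\aleph$ bits to define are the elements of $2^\aleph$, i.e. the binary sequences of length $o(\aleph)$; the sets of such sets, which require $\le 2^\aleph$ bits, are the $X\subseteq 2^\aleph$. A relation on $2^\aleph$ of finite arity is *recursive* if it is decided by a finite program on a serial machine with $\aleph$ registers in each set in $\le o(\aleph)$ steps. Formulas are built from recursive relations (given by their finite programs) and equations between variables $v_0,v_1,\dots$ ranging over $2^\aleph$, and memberships $v_i\in V_j$ with variables $V_0,V_1,\dots$ ranging over subsets of $2^\aleph$, by $\neg,\wedge,\vee,\to,\leftrightarrow$ and quantifiers; a formula is *first-order* if it has no quantifiers over the $V_j$. **Theorem 15.** For every formula $\varphi$ of one of the kinds below there are $n$ and a finite evaluation, i.e. a finite list of stages in each of which all machines run one and the same finite program and the management program then either copies the outputs or combines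 them over all values of one variable (starting with $1$ and writing $0$ if some output is $0$, or starting with $0$ and writing $1$ if some output is $1$), which depend only on $\varphi$ and such that for every infinite cardinal $\aleph$ the following holds. a) Let $\varphi$ be first-order without memberships. For every bijection of the indices $\gamma<o(2^\aleph)$ with the assignments of elements of $2^\aleph$ to $v_0,v_1,\dots$, some parallel $\langle 2^\aleph,\aleph,\aleph\rangle$-hypercomputer loads the values of $v_0,\dots,v_{n-1}$ under the $\gamma$-th assignment into machine $\gamma$, for all $\gamma$ in parallel, carries out the evaluation, and then holds on every machine $\gamma$ the truth value of $\varphi$ under the $\gamma$-th assignment (so the truth value of $\varphi$, if $\varphi$ is a sentence). b) Let $\varphi$ be first-order, memberships allowed. The same holds for all specific sets $X_0,X_1,\dots\subseteq 2^\aleph$ as values of $V_0,V_1,\dots$, where machine $\gamma$ also loads, for $j<n$, the bit that says whether its value of $v_0$ belongs to $X_j$ (so that the machines together hold each $X_j$ as a sequence of $2^\aleph$ bits). c) Let $\varphi$ be arbitrary (second-order). The same holds with a parallel $\langle 2^{2^\aleph},\aleph,\aleph\rangle$-hypercomputer whose machines are indexed by the assignments of values to all $v_i$ and all $V_j$, machine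 $\gamma$ loading the values of $v_0,\dots,v_{n-1}$ and the bits $[v_0\in V_j]$, $j<n$, under its own assignment. -/

import Mathlib

open Cardinal Ordinal

universe u

noncomputable section

namespace Hypercomputer

/-! ## Serial hypercomputers -/

/-- The sets of registers of a machine: read-only input sets `I_β`, read-write working sets `W_β`
and write-only output sets `O_β`. Each set is a tape of registers numbered by ordinals. -/
inductive RegSet : Type (u + 1)
  | input (β : Ordinal.{u})
  | work (β : Ordinal.{u})
  | output (β : Ordinal.{u})

/-- The sets of registers that an instruction can read (output registers are write-only). -/
inductive Source : Type (u + 1)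
  | input (β : Ordinal.{u})
  | work (β : Ordinal.{u})

def Source.regSet : Source.{u} → RegSet.{u}
  | .input β => .input β
  | .work β => .work β

/-- The actions: do nothing, write a bit to the current register of a working or output set, move
the current register of a set one place to the left or to the right, or reset it to `0`. -/
inductive Action : Type (u + 1)
  | nop
  | writeWork (β : Ordinal.{u}) (b : Bool)
  | writeOutput (β : Ordinal.{u}) (b : Bool)
  | left (R : RegSet.{u})
  | right (R : RegSet.{u})
  | reset (R : RegSet.{u})

/-- The entry of a program for one state: the set of registers that is read, and for each symbol
in its current register the action and the next state (`none`: no instruction applies). It groups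
the instructions ⟨state, register set, symbol, action, next state⟩ with the same first entry. -/
structure Entry : Type (u + 1) where
  source : Source.{u}
  instr : Bool → Option (Action.{u} × Ordinal.{u})

/-- A program: a table of entries indexed by ordinal states. A jump cannot pass a limit ordinal:
the next state `t` of a state `s` lies between the last limit `≤ s` and the next limit `> s`. -/
structure Program : Type (u + 1) where
  table : Ordinal.{u} → Option Entry.{u}
  near : ∀ s l b a t, table s = some l → l.instr b = some (a, t) → s < t + ω ∧ t < s + ω

/-- The length of a program: the number of states in its table. -/
def Program.length (P : Program.{u}) : Cardinal.{u + 1} := #{s : Ordinal.{u} // P.table s ≠ none}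

def RegSet.index : RegSet.{u} → Ordinal.{u}
  | .input β => β
  | .work β => β
  | .output β => β

/-- An action addresses only sets of registers with index `< o(N)`. -/
def Action.Fits (N : Cardinal.{u}) : Action.{u} → Prop
  | .nop => True
  | .writeWork β _ => β < N.ord
  | .writeOutput β _ => β < N.ord
  | .left R => R.index < N.ord
  | .right R => R.index < N.ord
  | .reset R => R.index < N.ord

/-- A program addresses only sets of registers with index `< o(N)`. -/
def Program.Fits (P : Program.{u}) (N : Cardinal.{u}) : Prop :=
  ∀ s l, P.table s = some l → l.source.regSet.index < N.ord ∧
    ∀ b a t, l.instr b = some (a, t) → a.Fits N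

/-- The contents of a family of sets of registers: `D β α` is the bit in register `α` of set `β`. -/
abbrev Data : Type (u + 1) := Ordinal.{u} → Ordinal.{u} → Bool

/-- A snapshot of a computation: the state, the current register of each set, all contents. -/
structure Config : Type (u + 1) where
  state : Ordinal.{u}
  head : RegSet.{u} → Ordinal.{u}
  mem : RegSet.{u} → Ordinal.{u} → Bool

/-- The initial snapshot: state `0`, current registers `0`, the given contents in the input
registers and `0` in all the others. -/
def Config.initial (D : Data.{u}) : Config.{u} where
  state := 0
  head := fun _ => 0
  mem := fun R => match R with
    | .input β => D β
    | .work _ => fun _ => false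
    | .output _ => fun _ => false

open Classical in
/-- Write `b` to the current register of `R`. -/
def Config.write (c : Config.{u}) (R : RegSet.{u}) (b : Bool) : Config.{u} :=
  { c with mem := Function.update c.mem R (Function.update (c.mem R) (c.head R) b) }

open Classical in
/-- Make register `α` the current register of `R`. -/
def Config.moveTo (c : Config.{u}) (R : RegSet.{u}) (α : Ordinal.{u}) : Config.{u} :=
  { c with head := Function.update c.head R α }

open Classical in
/-- The effect of an action when each set has the registers `α < o(N)`. A move to the left is
possible only from a successor (`pred` fixes all other ordinals), a move to the right only if
there is a register on the right. -/
def Config.act (N : Cardinal.{u}) (c : Config.{u}) : Action.{u} → Config.{u}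
  | .nop => c
  | .writeWork β b => c.write (.work β) b
  | .writeOutput β b => c.write (.output β) b
  | .left R => c.moveTo R (Ordinal.pred (c.head R))
  | .right R => if c.head R + 1 < N.ord then c.moveTo R (c.head R + 1) else c
  | .reset R => c.moveTo R 0

/-- One step: execute the instruction that applies. If none applies, the machine has halted and
its snapshot does not change any more. -/
def Program.step (N : Cardinal.{u}) (P : Program.{u}) (c : Config.{u}) : Config.{u} :=
  match P.table c.state with
  | none => c
  | some l =>
    match l.instr (c.mem l.source.regSet (c.head l.source.regSet)) with
    | none => c
    | some (a, t) => { c.act N a with state := t }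

/-- The least upper limit of a sequence of ordinals of limit length `o`. -/
def limsupOrd (o : Ordinal.{u}) (f : (α : Ordinal.{u}) → α < o → Ordinal.{u}) : Ordinal.{u} :=
  sInf {x | ∃ β < o, ∀ (α : Ordinal.{u}) (h : α < o), β ≤ α → f α h ≤ x}

open Classical in
/-- The least upper limit of a sequence of bits of limit length `o`. -/
def limsupBit (o : Ordinal.{u}) (f : (α : Ordinal.{u}) → α < o → Bool) : Bool :=
  decide (∀ β < o, ∃ (α : Ordinal.{u}) (h : α < o), β ≤ α ∧ f α h = true)

/-- The snapshot of the computation of `P` on input `D` at time `τ`; at limit times the state, the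
current registers and the contents are least upper limits. -/
def Program.run (N : Cardinal.{u}) (P : Program.{u}) (D : Data.{u}) (τ : Ordinal.{u}) :
    Config.{u} :=
  Ordinal.limitRecOn (motive := fun _ => Config.{u}) τ
    (Config.initial D)
    (fun _ c => P.step N c)
    (fun o _ f =>
      { state := limsupOrd o fun α h => (f α h).state
        head := fun R => limsupOrd o fun α h => (f α h).head R
        mem := fun R ζ => limsupBit o fun α h => (f α h).mem R ζ })

/-- The output of `P` on input `D` on a machine with `N` registers in each set and computations of
length `o(s)`: the contents of the output registers when no instruction applies any more, or when
the length `o(s)` is reached. -/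
def Program.result (N s : Cardinal.{u}) (P : Program.{u}) (D : Data.{u}) : Data.{u} :=
  fun β => (P.run N D s.ord).mem (.output β)

/-- A finite program. -/
structure FiniteProgram : Type (u + 1) extends Program.{u} where
  finite : toProgram.length < ℵ₀
  fits : toProgram.Fits ℵ₀

/-! ## Parallel hypercomputers -/

/-- The indices `γ < o(N)` of the serial machines of a parallel hypercomputer. -/
abbrev Idx (N : Cardinal.{u}) : Type (u + 1) := Set.Iio N.ord

/-- Programs `P_γ` of length `≤ p` for the `N` serial machines of a parallel hypercomputer. -/
structure ProgramFamily (N p : Cardinal.{u}) : Type (u + 1) where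
  prog : Idx N → Program.{u}
  length_le : ∀ γ, (prog γ).length ≤ Cardinal.lift.{u + 1} p
  fits : ∀ γ, (prog γ).Fits N

/-- One parallel hypercomputer in a chain, followed by a step of the management program. The
machines run independently on their own read-only input registers. Then the management program
first writes the bit `start` to each register of the set `dst` of each machine `γ`, and overwrites
register `α` by the opposite bit if some machine `δ ∈ sources γ` has the opposite bit in register
`α` of its output set `O_0`. (If `sources γ = {γ}`, this is copying.) -/
structure Stage (N p : Cardinal.{u}) extends ProgramFamily.{u} N p where
  dst : Ordinal.{u}
  dst_lt : dst < N.ord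
  start : Bool
  sources : Idx N → Set (Idx N)

open Classical in
/-- The management step, given the outputs of the machines. -/
def Stage.combine {N p : Cardinal.{u}} (S : Stage.{u} N p) (out : Idx N → Data.{u}) (γ : Idx N)
    (α : Ordinal.{u}) : Bool :=
  if ∃ δ ∈ S.sources γ, out δ 0 α ≠ S.start then !S.start else S.start

open Classical in
/-- The contents of the registers after a stage: all earlier contents remain available, and the
set `dst` holds what the management program has written. -/
def Stage.exec {N p : Cardinal.{u}} (s : Cardinal.{u}) (S : Stage.{u} N p)
    (store : Idx N → Data.{u}) (γ : Idx N) : Data.{u} :=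
  Function.update (store γ) S.dst
    (S.combine (fun δ => (S.prog δ).result N s (store δ)) γ)

/-- A (chained) parallel ⟨N, p, s⟩-hypercomputer with its programs: `N` serial machines with `N`
registers in each set, programs of length `≤ p` and computations of `≤ o(s)` steps. First the
programs `load` start with empty registers and their outputs become the initial contents; then
finitely many stages follow. -/
structure ParallelHypercomputer (N p s : Cardinal.{u}) : Type (u + 1) where
  le_steps : p ≤ s
  steps_le : s ≤ N
  load : ProgramFamily.{u} N p
  stages : List (Stage.{u} N p)

/-- What the machines have loaded before the first stage. -/
def ParallelHypercomputer.loaded {N p s : Cardinal.{u}} (M : ParallelHypercomputer.{u} N p s)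
    (γ : Idx N) : Data.{u} :=
  (M.load.prog γ).result N s fun _ _ => false

/-- The contents of the registers after all the stages. -/
def ParallelHypercomputer.final {N p s : Cardinal.{u}} (M : ParallelHypercomputer.{u} N p s) :
    Idx N → Data.{u} :=
  M.stages.foldl (fun store S => S.exec s store) M.loaded

/-! ## Propositions about sets of at most `κ` bits -/

/-- The binary `κ`-sequences, that is, the sets that require at most `κ` bits to define. -/
abbrev BinSeq (κ : Cardinal.{u}) : Type (u + 1) := Set.Iio κ.ord → Bool

open Classical in
/-- A binary `κ`-sequence written into a set of registers. -/
def BinSeq.tape {κ : Cardinal.{u}} (x : BinSeq κ) : Ordinal.{u} → Bool :=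
  fun α => if h : α < κ.ord then x ⟨α, h⟩ else false

open Classical in
/-- Finitely many binary `κ`-sequences in the sets of registers `0, 1, …, k - 1`. -/
def tuple {κ : Cardinal.{u}} {k : ℕ} (x : Fin k → BinSeq κ) : Data.{u} :=
  fun β α => if h : ∃ i : Fin k, β = (i : ℕ) then (x h.choose).tape α else false

/-- The relation between `k` binary `κ`-sequences that is decided by `P` on a serial hypercomputer
with `κ` registers in each set in `≤ o(κ)` steps: the output bit is in the first output register.
The relations of this form (with `P` finite) are the recursive relations. -/
def FiniteProgram.Accepts (P : FiniteProgram.{u}) (κ : Cardinal.{u}) {k : ℕ}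
    (x : Fin k → BinSeq κ) : Prop :=
  P.toProgram.result κ κ (tuple x) 0 0 = true

/-- Formulas with variables `v_0, v_1, …` for binary sequences and `V_0, V_1, …` for sets of
binary sequences. -/
inductive Formula : Type (u + 1)
  | rel (P : FiniteProgram.{u}) (k : ℕ) (v : Fin k → ℕ)
  | eq (i j : ℕ)
  | mem (i j : ℕ)
  | not (φ : Formula)
  | and (φ ψ : Formula)
  | or (φ ψ : Formula)
  | imp (φ ψ : Formula)
  | iff (φ ψ : Formula)
  | all (i : ℕ) (φ : Formula)
  | ex (i : ℕ) (φ : Formula)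
  | allSet (j : ℕ) (φ : Formula)
  | exSet (j : ℕ) (φ : Formula)

/-- Values of the variables `v_i` and `V_j`. -/
abbrev Assignment (κ : Cardinal.{u}) : Type (u + 1) := (ℕ → BinSeq κ) × (ℕ → Set (BinSeq κ))

/-- Truth of a formula over the binary `κ`-sequences and the sets of binary `κ`-sequences. -/
def Formula.Holds (κ : Cardinal.{u}) : Formula.{u} → Assignment κ → Prop
  | .rel P _ v, s => P.Accepts κ fun i => s.1 (v i)
  | .eq i j, s => s.1 i = s.1 j
  | .mem i j, s => s.1 i ∈ s.2 j
  | .not φ, s => ¬ φ.Holds κ s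
  | .and φ ψ, s => φ.Holds κ s ∧ ψ.Holds κ s
  | .or φ ψ, s => φ.Holds κ s ∨ ψ.Holds κ s
  | .imp φ ψ, s => φ.Holds κ s → ψ.Holds κ s
  | .iff φ ψ, s => (φ.Holds κ s ↔ ψ.Holds κ s)
  | .all i φ, s => ∀ x : BinSeq κ, φ.Holds κ (Function.update s.1 i x, s.2)
  | .ex i φ, s => ∃ x : BinSeq κ, φ.Holds κ (Function.update s.1 i x, s.2)
  | .allSet j φ, s => ∀ X : Set (BinSeq κ), φ.Holds κ (s.1, Function.update s.2 j X)
  | .exSet j φ, s => ∃ X : Set (BinSeq κ), φ.Holds κ (s.1, Function.update s.2 j X)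

/-- No quantifiers over sets of binary sequences. -/
def Formula.FirstOrder : Formula.{u} → Prop
  | .rel _ _ _ => True
  | .eq _ _ => True
  | .mem _ _ => True
  | .not φ => φ.FirstOrder
  | .and φ ψ => φ.FirstOrder ∧ ψ.FirstOrder
  | .or φ ψ => φ.FirstOrder ∧ ψ.FirstOrder
  | .imp φ ψ => φ.FirstOrder ∧ ψ.FirstOrder
  | .iff φ ψ => φ.FirstOrder ∧ ψ.FirstOrder
  | .all _ φ => φ.FirstOrder
  | .ex _ φ => φ.FirstOrder
  | .allSet _ _ => False
  | .exSet _ _ => False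

/-- No atomic formulas `v_i ∈ V_j`. -/
def Formula.MembershipFree : Formula.{u} → Prop
  | .rel _ _ _ => True
  | .eq _ _ => True
  | .mem _ _ => False
  | .not φ => φ.MembershipFree
  | .and φ ψ => φ.MembershipFree ∧ ψ.MembershipFree
  | .or φ ψ => φ.MembershipFree ∧ ψ.MembershipFree
  | .imp φ ψ => φ.MembershipFree ∧ ψ.MembershipFree
  | .iff φ ψ => φ.MembershipFree ∧ ψ.MembershipFree
  | .all _ φ => φ.MembershipFree
  | .ex _ φ => φ.MembershipFree
  | .allSet _ φ => φ.MembershipFree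
  | .exSet _ φ => φ.MembershipFree

/-! ## Evaluation of propositions in parallel -/

/-- What the management program does with the outputs of the machines: it copies the output of
each machine, or it combines the outputs over all values of one variable, starting with `1` and
writing `0` if some output is `0` (`start = true`), or starting with `0` and writing `1` if some
output is `1` (`start = false`). -/
inductive Combination : Type
  | copy
  | overSeq (start : Bool) (i : ℕ)
  | overSet (start : Bool) (j : ℕ)

/-- If machine `γ` works on the assignment `asg γ`, the machines whose outputs are combined for
machine `γ`. -/
def Combination.sources {κ N : Cardinal.{u}} (asg : Idx N → Assignment κ) :
    Combination → Idx N → Set (Idx N)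
  | .copy, γ => {γ}
  | .overSeq _ i, γ => {δ | ∃ x, asg δ = (Function.update (asg γ).1 i x, (asg γ).2)}
  | .overSet _ j, γ => {δ | ∃ X, asg δ = ((asg γ).1, Function.update (asg γ).2 j X)}

def Combination.start : Combination → Bool
  | .copy => true
  | .overSeq b _ => b
  | .overSet b _ => b

/-- One step of an evaluation: all machines run the same finite program, and the management
program puts the (combined) outputs into the set of registers `dst`. -/
structure EvalStep : Type (u + 1) where
  prog : FiniteProgram.{u}
  comb : Combination
  dst : ℕ

/-- A finite description of an evaluation: the number of variables of each sort whose values are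
loaded, the steps, and the set of registers whose first register holds the truth value. -/
structure Evaluation : Type (u + 1) where
  vars : ℕ
  steps : List EvalStep.{u}
  answer : ℕ

/-- A stage of a parallel hypercomputer carries out a step of an evaluation. -/
def EvalStep.CarriedOutBy {κ N p : Cardinal.{u}} (E : EvalStep.{u}) (asg : Idx N → Assignment κ)
    (S : Stage.{u} N p) : Prop :=
  (∀ γ, S.prog γ = E.prog.toProgram) ∧ S.dst = (E.dst : Ordinal.{u}) ∧
    S.start = E.comb.start ∧ S.sources = E.comb.sources asg

open Classical in
/-- The data of an assignment, for variables with index `< n`: the set of registers `2 i` holds the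
sequence `v_i`; the first register of the set `2 j + 1` holds the bit that says whether `v_0` is a
member of `V_j`. All other registers are empty. So machines with the values `x` for `v_0`, for all
`x`, together hold each set `V_j` as a sequence of `2 ^ κ` bits. -/
def Assignment.data {κ : Cardinal.{u}} (n : ℕ) (s : Assignment κ) : Data.{u} := fun β α =>
  if h : ∃ i : ℕ, i < n ∧ β = (2 * i : ℕ) then (s.1 h.choose).tape α
  else if h : ∃ j : ℕ, j < n ∧ β = (2 * j + 1 : ℕ) then decide (α = 0 ∧ s.1 0 ∈ s.2 h.choose)
  else false

/-- There is a parallel ⟨N, κ, κ⟩-hypercomputer that loads the data of the assignment `asg γ` into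
machine `γ`, for all `γ < o(N)` in parallel, then carries out the finite evaluation `E`, and then
has on each machine `γ` the truth value of `φ` for the assignment `asg γ`. -/
def Evaluation.Decides {κ N : Cardinal.{u}} (E : Evaluation.{u}) (asg : Idx N → Assignment κ)
    (φ : Formula.{u}) : Prop :=
  ∃ M : ParallelHypercomputer.{u} N κ κ,
    (∀ γ, M.loaded γ = (asg γ).data E.vars) ∧
    List.Forall₂ (fun e S => e.CarriedOutBy asg S) E.steps M.stages ∧
    ∀ γ, M.final γ E.answer 0 = true ↔ φ.Holds κ (asg γ)

theorem card_binSeq (κ : Cardinal.{u}) : #(BinSeq κ) = Cardinal.lift.{u + 1} ((2 : Cardinal.{u}) ^ κ) := by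
  simp [BinSeq, Cardinal.mk_Iio_ordinal]

/-- There are as many indices of machines as values of the variables `v_i`. -/
theorem nonempty_idx_equiv {κ : Cardinal.{u}} (hκ : ℵ₀ ≤ κ) :
    Nonempty (Idx ((2 : Cardinal.{u}) ^ κ) ≃ (ℕ → BinSeq κ)) := by
  rw [← Cardinal.eq, Cardinal.mk_Iio_ordinal, Cardinal.card_ord, Cardinal.mk_arrow, card_binSeq]
  have h : κ * ℵ₀ = κ := Cardinal.mul_eq_left hκ hκ Cardinal.aleph0_ne_zero
  simp only [Cardinal.lift_id', Cardinal.mk_nat, Cardinal.lift_aleph0]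
  rw [← Cardinal.lift_aleph0.{u + 1, u}, ← Cardinal.lift_power, ← Cardinal.power_mul, h]

/-- There are as many indices of machines as values of the variables `v_i` and `V_j`. -/
theorem nonempty_idx_equiv_assignment {κ : Cardinal.{u}} (hκ : ℵ₀ ≤ κ) :
    Nonempty (Idx ((2 : Cardinal.{u}) ^ ((2 : Cardinal.{u}) ^ κ)) ≃ Assignment κ) := by
  have hκ' : κ ≤ (2 : Cardinal.{u}) ^ κ := (Cardinal.cantor κ).le
  have h2 : ℵ₀ ≤ (2 : Cardinal.{u}) ^ κ := hκ.trans hκ'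
  have h2' : (2 : Cardinal.{u}) ^ κ ≤ (2 : Cardinal.{u}) ^ ((2 : Cardinal.{u}) ^ κ) :=
    (Cardinal.cantor _).le
  obtain ⟨e₁⟩ := nonempty_idx_equiv hκ
  have hc₁ : #(ℕ → BinSeq κ) = Cardinal.lift.{u + 1} ((2 : Cardinal.{u}) ^ κ) := by
    rw [← Cardinal.mk_congr e₁, Cardinal.mk_Iio_ordinal, Cardinal.card_ord]
  obtain ⟨e₂⟩ := nonempty_idx_equiv h2
  have e₃ : Set (BinSeq κ) ≃ BinSeq ((2 : Cardinal.{u}) ^ κ) := by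
    refine Classical.choice (Cardinal.eq.1 ?_)
    rw [card_binSeq, Cardinal.mk_set, card_binSeq]
    simp only [Cardinal.lift_power, Cardinal.lift_two]
  have hc₂ : #(ℕ → Set (BinSeq κ)) =
      Cardinal.lift.{u + 1} ((2 : Cardinal.{u}) ^ ((2 : Cardinal.{u}) ^ κ)) := by
    rw [Cardinal.mk_congr (Equiv.piCongrRight fun _ : ℕ => e₃), ← Cardinal.mk_congr e₂,
      Cardinal.mk_Iio_ordinal, Cardinal.card_ord]
  rw [← Cardinal.eq, Cardinal.mk_Iio_ordinal, Cardinal.card_ord, Cardinal.mk_prod, hc₁, hc₂,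
    Cardinal.lift_id, Cardinal.lift_id, ← Cardinal.lift_mul]
  congr 1
  exact (Cardinal.mul_eq_right (h2.trans h2') h2'
    (Cardinal.power_ne_zero _ two_ne_zero)).symm

end Hypercomputer

end

open Hypercomputer

/-!
A formula is evaluated bottom-up. The machines work on all assignments in parallel, and for each
subformula in turn every machine stores the truth value under its own assignment in register `0` of
a set of registers that was free before (`Computable`). The evaluation depends on the formula only,
because its programs are finite and their limit behaviour is the same for every infinite `κ`.

All the steps except those for recursive relations run the program `sweep`, which moves along two
sets of registers in rounds of four steps and so passes all registers `α < o(κ)` by time `o(κ)`. It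
copies, applies Boolean connectives, and finds out whether two sequences differ (`sweep_result`).
Its snapshot at time `τ` is described by conditions of the form `c * α + r < τ`, "step `r` of round
`α` is over", on the positions of heads and the contents of registers (`Paced`, `SweepInv`). They
are monotone in `τ` and thus survive least upper limits (`lt_limsupOrd_iff`, `limsupBit_iff`). The
loading program `loader` is treated in the same way.

* Quantifiers are the combinations of the management program, over the machines whose assignments
  differ in one variable. For each value of that variable there is such a machine (`SeqClosed`,
  `SetClosed`), since the machines are indexed by all assignments to the quantified variables.
* A recursive relation (`computable_rel`) is decided by its own program, with the numbers of its
  input sets shifted to free sets that hold copies of the arguments. Within `o(κ)` steps its heads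
  stay below `o(κ)`, so the larger number of registers does not matter
  (`FiniteProgram.shift_run`).
* Membership bits are loaded for `v_0` only; `v_i ∈ V_j` is evaluated as
  `∃ v_0, v_0 = v_i ∧ v_0 ∈ V_j` (`computable_mem`).
-/

namespace Hypercomputer

/-! ### Times of a periodic computation -/

/-- The time `r` of the `α`-th round of a computation with rounds of `c` steps. -/
def tick (c : ℕ) (α : Ordinal.{u}) (r : ℕ) : Ordinal.{u} := c * α + r

theorem tick_add_one (c : ℕ) (α : Ordinal.{u}) (r : ℕ) : tick c α r + 1 = tick c α (r + 1) := by
  simp [tick, add_assoc]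

theorem tick_self (c : ℕ) (α : Ordinal.{u}) : tick c α c = tick c (α + 1) 0 := by
  simp [tick, mul_add]

theorem tick_lt_tick_of_lt {c r : ℕ} (s : ℕ) {α β : Ordinal.{u}} (hr : r < c) (h : α < β) :
    tick c α r < tick c β s := by
  have h1 : tick c α r < tick c α c := by
    unfold tick
    gcongr
  have h2 : tick c (α + 1) 0 ≤ tick c β 0 := by
    unfold tick
    gcongr
    exact Order.add_one_le_of_lt h
  have h3 : tick c β 0 ≤ tick c β s := by
    unfold tick
    gcongr
    simp
  exact (h1.trans_eq (tick_self c α)).trans_le (h2.trans h3)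

theorem tick_lt_tick {c r s : ℕ} {α β : Ordinal.{u}} (hr : r < c) (hs : s < c) :
    tick c α r < tick c β s ↔ α < β ∨ α = β ∧ r < s := by
  rcases lt_trichotomy α β with h | rfl | h
  · simp [h, tick_lt_tick_of_lt s hr h]
  · simp [tick]
  · simp [h.not_gt, h.ne', (tick_lt_tick_of_lt r hs h).le]

theorem tick_inj {c r s : ℕ} {α β : Ordinal.{u}} (hr : r < c) (hs : s < c) :
    tick c α r = tick c β s ↔ α = β ∧ r = s := by
  refine ⟨fun h => ?_, fun h => by rw [h.1, h.2]⟩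
  have h1 := (tick_lt_tick (α := α) (β := β) hr hs).not.1 h.not_lt
  have h2 := (tick_lt_tick (α := β) (β := α) hs hr).not.1 h.not_gt
  push Not at h1 h2
  have h3 : α = β := le_antisymm h2.1 h1.1
  exact ⟨h3, le_antisymm (h2.2 h3.symm) (h1.2 h3)⟩

theorem tick_lt_tick_add_one {c r s : ℕ} {α β : Ordinal.{u}} (hr : r < c) (hs : s < c) :
    tick c α r < tick c β s + 1 ↔ tick c α r < tick c β s ∨ α = β ∧ r = s := by
  rw [Order.lt_add_one_iff, le_iff_lt_or_eq, tick_inj hr hs]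

theorem exists_eq_tick {c : ℕ} (hc : 0 < c) (τ : Ordinal.{u}) :
    ∃ α, ∃ r < c, τ = tick c α r := by
  have hc' : (c : Ordinal.{u}) ≠ 0 := by simpa using hc.ne'
  obtain ⟨r, hr⟩ := Ordinal.lt_omega0.1
    ((Ordinal.mod_lt τ hc').trans (Ordinal.natCast_lt_omega0 c))
  refine ⟨τ / c, r, ?_, ?_⟩
  · have := Ordinal.mod_lt τ hc'
    rw [hr] at this
    exact_mod_cast this
  · rw [tick, ← hr, Ordinal.div_add_mod]

theorem le_tick {c : ℕ} (hc : 0 < c) (α : Ordinal.{u}) (r : ℕ) : α ≤ tick c α r := by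
  have h : (1 : Ordinal.{u}) ≤ c := by exact_mod_cast hc
  calc α = 1 * α := (one_mul α).symm
    _ ≤ c * α := by gcongr
    _ ≤ tick c α r := le_self_add

theorem tick_lt_ord {κ : Cardinal.{u}} (hκ : ℵ₀ ≤ κ) {c : ℕ} (hc : 0 < c) {α : Ordinal.{u}}
    (r : ℕ) : tick c α r < κ.ord ↔ α < κ.ord := by
  refine ⟨(le_tick hc α r).trans_lt, fun h => ?_⟩
  have hn (n : ℕ) : (n : Ordinal.{u}) < κ.ord :=
    (Ordinal.natCast_lt_omega0 n).trans_le (by rwa [← Cardinal.ord_aleph0, Cardinal.ord_le_ord])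
  exact isPrincipal_add_ord hκ (isPrincipal_mul_ord hκ (hn c) h) (hn r)

theorem eq_zero_of_isSuccLimit_tick {c r : ℕ} {α : Ordinal.{u}}
    (h : Order.IsSuccLimit (tick c α r)) : r = 0 := by
  cases r with
  | zero => rfl
  | succ r =>
    rw [← tick_add_one, ← Order.succ_eq_add_one] at h
    exact absurd h (Order.not_isSuccLimit_succ _)

/-! ### Least upper limits -/

theorem limsupOrd_eq_of_frequently {o m : Ordinal.{u}} {f : (τ : Ordinal.{u}) → τ < o → Ordinal.{u}}
    (h0 : 0 < o) (hle : ∀ τ h, f τ h ≤ m) (hfreq : ∀ β < o, ∃ τ h, β ≤ τ ∧ f τ h = m) :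
    limsupOrd o f = m := by
  refine le_antisymm (csInf_le' ⟨0, h0, fun τ h _ => hle τ h⟩) ?_
  refine le_csInf ⟨m, 0, h0, fun τ h _ => hle τ h⟩ ?_
  rintro x ⟨β, hβ, hx⟩
  obtain ⟨τ, h, hτ, rfl⟩ := hfreq β hβ
  exact hx τ h hτ

theorem limsupOrd_le {o m : Ordinal.{u}} {f : (τ : Ordinal.{u}) → τ < o → Ordinal.{u}}
    (h0 : 0 < o) (hle : ∀ τ h, f τ h ≤ m) : limsupOrd o f ≤ m :=
  csInf_le' ⟨0, h0, fun τ h _ => hle τ h⟩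

/-- If `f` exceeds `α` exactly after time `g α`, then so does its least upper limit. The bound
`f τ ≤ τ` ensures that the set in `limsupOrd` is not empty. -/
theorem lt_limsupOrd_iff {o : Ordinal.{u}} {f : (τ : Ordinal.{u}) → τ < o → Ordinal.{u}}
    (ho : Order.IsSuccLimit o) {g : Ordinal.{u} → Ordinal.{u}}
    (hf : ∀ τ h α, α < f τ h ↔ g α < τ) (hle : ∀ τ h, f τ h ≤ τ) (α : Ordinal.{u}) :
    α < limsupOrd o f ↔ g α < o := by
  have h0 : 0 < o := ho.bot_lt
  constructor
  · intro h
    by_contra hg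
    refine h.not_ge (limsupOrd_le h0 fun τ hτ => ?_)
    by_contra! hlt
    exact hg (((hf τ hτ α).1 hlt).trans hτ)
  · intro hg
    have hne : {x | ∃ β < o, ∀ (τ : Ordinal.{u}) (h : τ < o), β ≤ τ → f τ h ≤ x}.Nonempty :=
      ⟨o, 0, h0, fun τ h _ => (hle τ h).trans h.le⟩
    obtain ⟨β, hβ, hx⟩ := csInf_mem hne
    have hg' : g α + 1 < o := ho.add_one_lt hg
    refine lt_of_lt_of_le ((hf _ (max_lt hβ hg') α).2 ?_) (hx _ (max_lt hβ hg') (le_max_left _ _))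
    exact (Order.lt_add_one_iff.2 le_rfl).trans_le (le_max_right _ _)

/-- If `f` becomes true exactly after one of the times `g i` with `p i`, then so does its least
upper limit. -/
theorem limsupBit_iff {ι : Type*} {o : Ordinal.{u}} {f : (τ : Ordinal.{u}) → τ < o → Bool}
    (ho : Order.IsSuccLimit o) {p : ι → Prop} {g : ι → Ordinal.{u}}
    (hf : ∀ τ h, f τ h = true ↔ ∃ i, p i ∧ g i < τ) :
    limsupBit o f = true ↔ ∃ i, p i ∧ g i < o := by
  simp only [limsupBit, decide_eq_true_iff]
  constructor
  · intro h
    obtain ⟨τ, hτ, -, ht⟩ := h 0 ho.bot_lt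
    obtain ⟨i, hp, hg⟩ := (hf τ hτ).1 ht
    exact ⟨i, hp, hg.trans hτ⟩
  · rintro ⟨i, hp, hg⟩ β hβ
    refine ⟨_, max_lt hβ (ho.add_one_lt hg), le_max_left _ _, (hf _ _).2 ⟨i, hp, ?_⟩⟩
    exact (Order.lt_add_one_iff.2 le_rfl).trans_le (le_max_right _ _)

theorem limsupBit_const {o : Ordinal.{u}} (ho : 0 < o) {b : Bool}
    {f : (τ : Ordinal.{u}) → τ < o → Bool} (hf : ∀ τ h, f τ h = b) : limsupBit o f = b := by
  rw [Bool.eq_iff_iff]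
  simp only [limsupBit, decide_eq_true_iff, hf]
  exact ⟨fun h => (h 0 ho).choose_spec.choose_spec.2, fun h β hβ => ⟨β, hβ, le_rfl, h⟩⟩

/-! ### Runs of programs -/

variable {N κ : Cardinal.{u}}

theorem Program.run_zero (P : Program.{u}) (D : Data.{u}) : P.run N D 0 = Config.initial D :=
  Ordinal.limitRecOn_zero ..

theorem Program.run_add_one (P : Program.{u}) (D : Data.{u}) (τ : Ordinal.{u}) :
    P.run N D (τ + 1) = P.step N (P.run N D τ) :=
  Ordinal.limitRecOn_add_one ..

theorem Program.run_limit (P : Program.{u}) (D : Data.{u}) {o : Ordinal.{u}}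
    (ho : Order.IsSuccLimit o) :
    P.run N D o =
      { state := limsupOrd o fun τ _ => (P.run N D τ).state
        head := fun R => limsupOrd o fun τ _ => (P.run N D τ).head R
        mem := fun R ζ => limsupBit o fun τ _ => (P.run N D τ).mem R ζ } :=
  Ordinal.limitRecOn_limit _ _ _ _ ho

theorem Program.step_of_instr {P : Program.{u}} {c : Config.{u}} {l : Entry.{u}} {a : Action.{u}}
    {t : Ordinal.{u}} (hl : P.table c.state = some l)
    (ha : l.instr (c.mem l.source.regSet (c.head l.source.regSet)) = some (a, t)) :
    P.step N c = { c.act N a with state := t } := by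
  simp only [Program.step, hl, ha]

theorem Config.act_mem_input (c : Config.{u}) (a : Action.{u}) (β : Ordinal.{u}) :
    (c.act N a).mem (.input β) = c.mem (.input β) := by
  cases a <;> simp only [Config.act, Config.write, Config.moveTo]
  · simp
  · simp
  · split_ifs <;> rfl

theorem Program.run_mem_input (P : Program.{u}) (D : Data.{u}) (β τ : Ordinal.{u}) :
    (P.run N D τ).mem (.input β) = D β := by
  induction τ using Ordinal.limitRecOn with
  | zero => rw [P.run_zero]; rfl
  | add_one τ ih =>
    rw [P.run_add_one, Program.step]
    split
    · exact ih
    · split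
      · exact ih
      · exact (Config.act_mem_input _ _ _).trans ih
  | limit o ho ih =>
    rw [P.run_limit D ho]
    funext ζ
    exact limsupBit_const ho.bot_lt fun τ hτ => by rw [ih τ hτ]

theorem Config.act_head_le {c : Config.{u}} {τ : Ordinal.{u}} (h : ∀ R, c.head R ≤ τ)
    (a : Action.{u}) (R : RegSet.{u}) : (c.act N a).head R ≤ τ + 1 := by
  have h1 : ∀ R, c.head R ≤ τ + 1 := fun R => (h R).trans le_self_add
  have h2 : ∀ R' α, α ≤ τ + 1 → (c.moveTo R' α).head R ≤ τ + 1 := by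
    intro R' α hα
    unfold Config.moveTo
    by_cases hR : R = R'
    · subst hR; simpa using hα
    · simpa [hR] using h1 R
  cases a with
  | nop => exact h1 R
  | writeWork β b => exact h1 R
  | writeOutput β b => exact h1 R
  | left R' => exact h2 _ _ ((Ordinal.pred_le_self _).trans (h1 R'))
  | right R' =>
    simp only [Config.act]
    split_ifs
    · exact h2 _ _ (by gcongr; exact h R')
    · exact h1 R
  | reset R' => exact h2 _ _ zero_le

/-- A head cannot move faster than one register per step. -/
theorem Program.run_head_le (P : Program.{u}) (D : Data.{u}) (τ : Ordinal.{u}) :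
    ∀ R, (P.run N D τ).head R ≤ τ := by
  induction τ using Ordinal.limitRecOn with
  | zero => intro R; rw [P.run_zero]; exact le_rfl
  | add_one τ ih =>
    intro R
    rw [P.run_add_one, Program.step]
    split
    · exact (ih R).trans le_self_add
    · split
      · exact (ih R).trans le_self_add
      · exact Config.act_head_le ih _ R
  | limit o ho ih =>
    intro R
    rw [P.run_limit D ho]
    exact limsupOrd_le ho.bot_lt fun τ hτ => (ih τ hτ R).trans hτ.le

/-! ### Heads that advance once in each round -/

/-- At time `τ`, the position `h` is that of a head that starts at register `0` and moves to the
right at step `r` of each round of `c` steps. -/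
def Paced (c r : ℕ) (h τ : Ordinal.{u}) : Prop :=
  ∀ α, α < h ↔ tick c α r < τ

theorem Paced.zero (c r : ℕ) : Paced.{u} c r 0 0 := by
  intro α
  simp

theorem Paced.eq {c r s : ℕ} {h β : Ordinal.{u}} (hp : Paced c r h (tick c β s)) (hs : s < c)
    (hsr : s ≤ r) (hr : r < c) : h = β := by
  refine eq_of_forall_lt_iff fun α => ?_
  rw [hp α, tick_lt_tick hr hs]
  exact or_iff_left fun h => hsr.not_gt h.2

theorem Paced.stay {c r s : ℕ} {h β : Ordinal.{u}} (hp : Paced c r h (tick c β s)) (hs : s < c)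
    (hr : r < c) (hrs : r ≠ s) : Paced c r h (tick c β s + 1) := by
  intro α
  rw [hp α, tick_lt_tick_add_one hr hs]
  exact (or_iff_left fun h => hrs h.2).symm

theorem Paced.move {c r : ℕ} {h β : Ordinal.{u}} (hp : Paced c r h (tick c β r))
    (hr : r < c) : Paced c r (h + 1) (tick c β r + 1) := by
  intro α
  rw [Order.lt_add_one_iff, le_iff_lt_or_eq, hp α, tick_lt_tick_add_one hr hr,
    hp.eq hr le_rfl hr]
  simp

theorem Paced.limit {P : Program.{u}} {D : Data.{u}} {c r : ℕ} {o : Ordinal.{u}}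
    (ho : Order.IsSuccLimit o) {R : RegSet.{u}}
    (hp : ∀ τ < o, Paced c r ((P.run N D τ).head R) τ) :
    Paced c r ((P.run N D o).head R) o := by
  rw [P.run_limit D ho]
  exact lt_limsupOrd_iff ho hp fun τ _ => P.run_head_le D τ R

/-! ### Sweeping over two sets of registers -/

/-- The table of the program `sweep`. The entry for state `0` is that for state `5`. -/
def sweepEntry (a b : ℕ) (f : Bool → Bool → Bool) (adv : Bool) : ℕ → Entry.{u}
  | 1 => ⟨.input b, fun y => some (if f false y then .writeOutput 0 true else .nop, 3)⟩
  | 2 => ⟨.input b, fun y => some (if f true y then .writeOutput 0 true else .nop, 3)⟩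
  | 3 => ⟨.input b, fun _ => some (.right (.input b), 4)⟩
  | 4 => ⟨.input b, fun _ => some (if adv then .right (.output 0) else .nop, 5)⟩
  | _ => ⟨.input a, fun x => some (.right (.input a), if x then 2 else 1)⟩

theorem sweepEntry_next {a b : ℕ} {f : Bool → Bool → Bool} {adv x : Bool} {n : ℕ}
    {A : Action.{u}} {t : Ordinal.{u}}
    (h : (sweepEntry a b f adv n).instr x = some (A, t)) : ∃ m : ℕ, t = m := by
  unfold sweepEntry at h
  split at h <;> simp only [Option.some.injEq, Prod.mk.injEq] at h <;> rw [← h.2]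
  · exact ⟨3, by simp⟩
  · exact ⟨3, by simp⟩
  · exact ⟨4, by simp⟩
  · exact ⟨5, by simp⟩
  · split
    · exact ⟨2, by simp⟩
    · exact ⟨1, by simp⟩

theorem sweepEntry_fits (a b : ℕ) (f : Bool → Bool → Bool) (adv : Bool) (n : ℕ) :
    (sweepEntry.{u} a b f adv n).source.regSet.index < (ℵ₀ : Cardinal.{u}).ord ∧
      ∀ x A t, (sweepEntry.{u} a b f adv n).instr x = some (A, t) → A.Fits ℵ₀ := by
  unfold sweepEntry
  split <;> refine ⟨by simp [Source.regSet, RegSet.index], fun x A t h => ?_⟩ <;>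
    simp only [Option.some.injEq, Prod.mk.injEq] at h <;> rw [← h.1]
  · split <;> simp [Action.Fits]
  · split <;> simp [Action.Fits]
  · simp [Action.Fits, RegSet.index]
  · split <;> simp [Action.Fits, RegSet.index]
  · simp [Action.Fits, RegSet.index]

open Classical in
/-- The program that reads the input sets `a` and `b` in parallel, register by register, in rounds
of four steps: read `x` in `a` and move on; read `y` in `b` and write `1` to `O_0` if `f x y`; move
on in `b`; if `adv`, move on in `O_0`. A round starts in state `5`, the largest one, since this is
the state at limit times. -/
noncomputable def sweep (a b : ℕ) (f : Bool → Bool → Bool) (adv : Bool) : FiniteProgram.{u} where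
  table s := if s < 6 then some (sweepEntry a b f adv s.card.toNat) else none
  near := by
    intro s l x A t hl ha
    split_ifs at hl with hs
    simp only [Option.some.injEq] at hl
    subst hl
    obtain ⟨m, rfl⟩ := sweepEntry_next ha
    obtain ⟨k, rfl⟩ := Ordinal.lt_omega0.1 (hs.trans (Ordinal.natCast_lt_omega0 6))
    exact ⟨(Ordinal.natCast_lt_omega0 k).trans_le le_add_self,
      (Ordinal.natCast_lt_omega0 m).trans_le le_add_self⟩
  finite := by
    rw [Program.length, Cardinal.lt_aleph0_iff_finite]
    have : Finite (Set.Iio (6 : Ordinal.{u})) := by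
      rw [← Cardinal.lt_aleph0_iff_finite, Cardinal.mk_Iio_ordinal]
      simp
    refine Set.Finite.subset (s := Set.Iio (6 : Ordinal.{u})) this fun s hs => ?_
    by_contra h
    exact hs (if_neg h)
  fits := by
    intro s l hl
    dsimp only at hl
    split_ifs at hl
    simp only [Option.some.injEq] at hl
    subst hl
    exact sweepEntry_fits ..

theorem sweep_table (a b : ℕ) (f : Bool → Bool → Bool) (adv : Bool) {n : ℕ} (hn : n < 6) :
    (sweep.{u} a b f adv).table n = some (sweepEntry a b f adv n) := by
  have : (n : Ordinal.{u}) < 6 := by exact_mod_cast hn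
  simp [sweep, this]

/-- The state before step `r` of a round of `sweep` in which `x` is the bit read in `a`. -/
def sweepState (x : Bool) : ℕ → ℕ
  | 0 => 5
  | 1 => if x then 2 else 1
  | 2 => 3
  | _ => 4

theorem sweepState_le (x : Bool) (r : ℕ) : sweepState x r ≤ 5 := by
  unfold sweepState
  cases x <;> split <;> norm_num

/-- The snapshot `c` of `sweep a b f adv` on input `D` at time `τ`. -/
structure SweepInv (a b : ℕ) (f : Bool → Bool → Bool) (adv : Bool) (D : Data.{u}) (τ : Ordinal.{u})
    (c : Config.{u}) : Prop where
  state : ∀ α, ∀ r < 4, τ = tick 4 α r → τ ≠ 0 → c.state = (sweepState (D a α) r : ℕ)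
  state_zero : τ = 0 → c.state = 0
  mem : ∀ β, c.mem (.input β) = D β
  head_a : Paced 4 0 (c.head (.input a)) τ
  head_b : Paced 4 2 (c.head (.input b)) τ
  head_out : if adv then Paced 4 3 (c.head (.output 0)) τ else c.head (.output 0) = 0
  out : ∀ ζ, c.mem (.output 0) ζ = true ↔
    ∃ α, ((if adv then α else 0) = ζ ∧ f (D a α) (D b α) = true) ∧ tick 4 α 1 < τ

theorem SweepInv.step {a b : ℕ} (hab : a ≠ b) {f : Bool → Bool → Bool} {adv : Bool} {D : Data.{u}}
    {τ : Ordinal.{u}} {c : Config.{u}} (hN : ℵ₀ ≤ N) (h : SweepInv a b f adv D τ c)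
    (hτ : τ < N.ord) :
    SweepInv a b f adv D (τ + 1) ((sweep a b f adv).step N c) := by
  obtain ⟨α, r, hr, rfl⟩ := exists_eq_tick (c := 4) (by norm_num) τ
  have hα : α + 1 < N.ord :=
    (Cardinal.isSuccLimit_ord hN).add_one_lt ((tick_lt_ord hN (by norm_num) _).1 hτ)
  have hα' := h.head_a
  have hβ' := h.head_b
  have hout := h.head_out
  have hmem := h.mem
  have hst := h.state α r hr rfl
  obtain rfl | rfl | rfl | rfl : r = 0 ∨ r = 1 ∨ r = 2 ∨ r = 3 := by omega
  · have ha : c.head (.input a) = α := hα'.eq (by norm_num) (by norm_num) (by norm_num)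
    have hs : ∃ n < 6, c.state = (n : ℕ) ∧ sweepEntry.{u} a b f adv n =
        ⟨.input a, fun x => some (.right (.input a), if x then 2 else 1)⟩ := by
      by_cases h0 : tick 4 α 0 = 0
      · exact ⟨0, by norm_num, by simpa using h.state_zero h0, rfl⟩
      · exact ⟨5, by norm_num, hst h0, rfl⟩
    obtain ⟨n, hn, hcn, he⟩ := hs
    rw [Program.step_of_instr (l := sweepEntry a b f adv n) (a := .right (.input a))
      (t := if D a α then 2 else 1) (by rw [hcn]; exact sweep_table a b f adv hn)
      (by rw [he]; simp [Source.regSet, ha, hmem])]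
    simp only [Config.act, ha, hα, if_true, Config.moveTo]
    constructor
    · intro β s hs hβ _
      rw [tick_add_one, tick_inj (by norm_num) hs] at hβ
      obtain ⟨rfl, rfl⟩ := hβ
      simp only [sweepState]
      split_ifs <;> simp
    · intro h0; simp at h0
    · exact hmem
    · have := hα'.move (by norm_num)
      simpa [ha] using this
    · have := hβ'.stay (by norm_num) (by norm_num) (by norm_num)
      simpa [hab.symm] using this
    · cases adv
      · simpa using hout
      · have := Paced.stay hout (by norm_num) (by norm_num) (by norm_num)
        simpa using this
    · intro ζ
      simp only [h.out, tick_lt_tick_add_one (c := 4) (r := 1) (s := 0) (by norm_num) (by norm_num)]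
      simp
  · have hb : c.head (.input b) = α := hβ'.eq (by norm_num) (by norm_num) (by norm_num)
    have h0 : c.head (.output 0) = if adv then α else 0 := by
      cases adv
      · simpa using hout
      · exact Paced.eq hout (by norm_num) (by norm_num) (by norm_num)
    rw [Program.step_of_instr (l := sweepEntry a b f adv (sweepState (D a α) 1))
      (a := if f (D a α) (D b α) then .writeOutput 0 true else .nop)
      (t := 3)
      (by
        rw [hst (by simp [tick])]
        exact sweep_table a b f adv (Nat.lt_succ_of_le (sweepState_le _ _)))
      (by cases hx : D a α <;> simp [sweepState, sweepEntry, Source.regSet, hb, hmem])]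
    have hact : ∀ R, (c.act N (if f (D a α) (D b α) then .writeOutput 0 true else .nop)).head R =
        c.head R := by
      intro R; split_ifs <;> rfl
    constructor
    · intro β s hs hβ _
      rw [tick_add_one, tick_inj (by norm_num) hs] at hβ
      obtain ⟨rfl, rfl⟩ := hβ
      simp [sweepState]
    · intro h0; simp at h0
    · intro β; exact (Config.act_mem_input ..).trans (hmem β)
    · have := hα'.stay (by norm_num) (by norm_num) (by norm_num)
      simpa [hact] using this
    · have := hβ'.stay (by norm_num) (by norm_num) (by norm_num)
      simpa [hact] using this
    · cases adv
      · simpa [hact] using hout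
      · have := Paced.stay hout (by norm_num) (by norm_num) (by norm_num)
        simpa [hact] using this
    · intro ζ
      simp only [tick_lt_tick_add_one (c := 4) (r := 1) (s := 1) (by norm_num) (by norm_num),
        and_true, and_or_left, exists_or, exists_eq_right, ← h.out]
      by_cases hf : f (D a α) (D b α) = true
      · simp only [hf, if_true, Config.act, Config.write, Function.update_self, h0, and_true]
        by_cases hζ : ζ = if adv then α else 0
        · subst hζ; simp
        · simp [hζ, Ne.symm hζ]
      · simp [hf, Config.act]
  · have hb : c.head (.input b) = α := hβ'.eq (by norm_num) (by norm_num) (by norm_num)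
    rw [Program.step_of_instr (l := sweepEntry a b f adv 3) (a := .right (.input b)) (t := 4)
      (by
        rw [hst (by simp [tick])]
        exact sweep_table a b f adv (Nat.lt_succ_of_le (sweepState_le _ _)))
      (by simp [sweepEntry])]
    simp only [Config.act, hb, hα, if_true, Config.moveTo]
    constructor
    · intro β s hs hβ _
      rw [tick_add_one, tick_inj (by norm_num) hs] at hβ
      obtain ⟨rfl, rfl⟩ := hβ
      simp [sweepState]
    · intro h0; simp at h0
    · exact hmem
    · have := hα'.stay (by norm_num) (by norm_num) (by norm_num)
      simpa [hab] using this
    · have := hβ'.move (by norm_num)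
      simpa [hb] using this
    · cases adv
      · simpa using hout
      · have := Paced.stay hout (by norm_num) (by norm_num) (by norm_num)
        simpa using this
    · intro ζ
      simp only [h.out, tick_lt_tick_add_one (c := 4) (r := 1) (s := 2) (by norm_num) (by norm_num)]
      simp
  · rw [Program.step_of_instr (l := sweepEntry a b f adv 4)
      (a := if adv then .right (.output 0) else .nop) (t := 5)
      (by
        rw [hst (by simp [tick])]
        exact sweep_table a b f adv (Nat.lt_succ_of_le (sweepState_le _ _)))
      (by simp [sweepEntry])]
    have hact : ∀ R, (c.act N (if adv then .right (.output 0) else .nop)).mem R = c.mem R := by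
      intro R; split_ifs <;> simp only [Config.act] ; split_ifs <;> rfl
    have hact' : ∀ d, (c.act N (if adv then .right (.output 0) else .nop)).head (.input d) =
        c.head (.input d) := by
      intro R; split_ifs <;> simp only [Config.act] ; split_ifs <;> simp [Config.moveTo]
    constructor
    · intro β s hs hβ _
      rw [tick_add_one, tick_self, tick_inj (by norm_num) hs] at hβ
      obtain ⟨rfl, rfl⟩ := hβ
      simp [sweepState]
    · intro h0; simp at h0
    · intro β; exact (hact _).trans (hmem β)
    · have := hα'.stay (by norm_num) (by norm_num) (by norm_num)
      simpa [hact'] using this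
    · have := hβ'.stay (by norm_num) (by norm_num) (by norm_num)
      simpa [hact'] using this
    · cases adv
      · simpa [Config.act] using hout
      · have h3 : c.head (.output 0) = α :=
          Paced.eq hout (by norm_num) (by norm_num) (by norm_num)
        have := Paced.move hout (by norm_num)
        simpa [Config.act, h3, hα, Config.moveTo] using this
    · intro ζ
      simp only [hact, h.out,
        tick_lt_tick_add_one (c := 4) (r := 1) (s := 3) (by norm_num) (by norm_num)]
      simp

theorem SweepInv.run {a b : ℕ} (hab : a ≠ b) (f : Bool → Bool → Bool) (adv : Bool) (D : Data.{u})
    (hN : ℵ₀ ≤ N) {τ : Ordinal.{u}} (hτ : τ ≤ N.ord) :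
    SweepInv a b f adv D τ ((sweep a b f adv).run N D τ) := by
  induction τ using Ordinal.limitRecOn with
  | zero =>
    rw [Program.run_zero]
    refine ⟨fun _ _ _ _ h => absurd rfl h, fun _ => rfl, fun _ => rfl, Paced.zero _ _,
      Paced.zero _ _, ?_, by simp [Config.initial]⟩
    split_ifs
    exacts [Paced.zero _ _, rfl]
  | add_one τ ih =>
    rw [Program.run_add_one]
    have hτ' : τ < N.ord := (Order.lt_add_one_iff.2 le_rfl).trans_le hτ
    exact (ih hτ'.le).step hab hN hτ'
  | limit o ho ih =>
    replace ih := fun τ (h : τ < o) => ih τ h (h.le.trans hτ)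
    refine ⟨?_, fun h => absurd h ho.ne_bot, fun β => Program.run_mem_input ..,
      Paced.limit ho fun τ h => (ih τ h).head_a, Paced.limit ho fun τ h => (ih τ h).head_b, ?_, ?_⟩
    · rintro α r hr rfl -
      obtain rfl := eq_zero_of_isSuccLimit_tick ho
      rw [Program.run_limit _ _ ho]
      refine limsupOrd_eq_of_frequently ho.bot_lt (fun τ h => ?_) (fun β hβ => ?_)
      · by_cases h0 : τ = 0
        · rw [(ih τ h).state_zero h0]; exact zero_le
        · obtain ⟨γ, s, hs, hτ⟩ := exists_eq_tick (c := 4) (by norm_num) τ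
          rw [(ih τ h).state γ s hs hτ h0]
          norm_cast
          exact sweepState_le _ _
      · obtain ⟨γ, s, hs, rfl⟩ := exists_eq_tick (c := 4) (by norm_num) β
        have hlt : tick 4 γ s < tick 4 (γ + 1) 0 :=
          tick_lt_tick_of_lt 0 hs (Order.lt_add_one_iff.2 le_rfl)
        have hlt' : tick 4 (γ + 1) 0 < tick 4 α 0 := by
          rw [← tick_self]
          have h1 : tick 4 γ 0 < tick 4 α 0 := lt_of_le_of_lt (by simp [tick]) hβ
          have := ho.add_natCast_lt h1 4
          simpa [tick] using this
        exact ⟨_, hlt', hlt.le, (ih _ hlt').state (γ + 1) 0 (by norm_num) rfl (ne_bot_of_gt hlt)⟩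
    · split_ifs with hadv
      · exact Paced.limit ho fun τ h => by simpa [hadv] using (ih τ h).head_out
      · rw [Program.run_limit _ _ ho]
        refine limsupOrd_eq_of_frequently ho.bot_lt (fun τ h => ?_) (fun β hβ => ?_)
        · have := (ih τ h).head_out
          rw [if_neg hadv] at this
          exact this.le
        · exact ⟨β, hβ, le_rfl, by simpa [hadv] using (ih β hβ).head_out⟩
    · intro ζ
      rw [Program.run_limit _ _ ho]
      exact limsupBit_iff ho fun τ h => (ih τ h).out ζ

/-- With `adv`, the output is `f` applied register by register. Without, register `0` tells whether
`f` holds anywhere. -/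
theorem sweep_result {a b : ℕ} (hab : a ≠ b) (f : Bool → Bool → Bool) (adv : Bool) (D : Data.{u})
    (hκ : ℵ₀ ≤ κ) (hN : κ ≤ N) (ζ : Ordinal.{u}) :
    (sweep a b f adv).result N κ D 0 ζ = true ↔
      ∃ α < κ.ord, (if adv then α else 0) = ζ ∧ f (D a α) (D b α) = true := by
  rw [Program.result,
    (SweepInv.run hab f adv D (hκ.trans hN) (Cardinal.ord_le_ord.2 hN)).out]
  simp only [tick_lt_ord hκ (c := 4) (by norm_num)]
  exact exists_congr fun α => and_comm

/-! ### Loading given contents -/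

/-- The instruction executed at time `s` by a machine that writes the contents `D` of the sets
`0, …, k - 1`: in round `α`, for each `i < k`, write register `α` of set `i` and move on. -/
noncomputable def loaderAction (k : ℕ) (D : Data.{u}) (s : Ordinal.{u}) : Action.{u} :=
  let r := (s % (2 * k : ℕ)).card.toNat
  if r % 2 = 0 then .writeOutput (r / 2 : ℕ) (D (r / 2 : ℕ) (s / (2 * k : ℕ)))
  else .right (.output (r / 2 : ℕ))

theorem loaderAction_tick {k r : ℕ} (D : Data.{u}) (α : Ordinal.{u}) (hr : r < 2 * k) :
    loaderAction k D (tick (2 * k) α r) =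
      if r % 2 = 0 then .writeOutput (r / 2 : ℕ) (D (r / 2 : ℕ) α)
      else .right (.output (r / 2 : ℕ)) := by
  have h : (r : Ordinal.{u}) < (2 * k : ℕ) := by exact_mod_cast hr
  have h0 : ((2 * k : ℕ) : Ordinal.{u}) ≠ 0 := by
    have : 2 * k ≠ 0 := by omega
    exact_mod_cast this
  have h1 : tick (2 * k) α r / (2 * k : ℕ) = α := by
    rw [tick, Ordinal.mul_add_div _ h0, Ordinal.div_eq_zero_of_lt h, add_zero]
  have h2 : tick (2 * k) α r % (2 * k : ℕ) = r := by
    rw [tick, Ordinal.mul_add_mod_self, Ordinal.mod_eq_of_lt h]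
  rw [loaderAction, h1, h2]
  simp

open Classical in
/-- The straight-line program of length `κ` that writes the contents `D` of the registers
`α < o(κ)` of the sets `0, …, k - 1`. -/
noncomputable def loader (κ : Cardinal.{u}) (k : ℕ) (D : Data.{u}) : Program.{u} where
  table s := if s < κ.ord then some ⟨.input 0, fun _ => some (loaderAction k D s, s + 1)⟩ else none
  near := by
    intro s l x A t hl ha
    split_ifs at hl with hs
    simp only [Option.some.injEq] at hl
    subst hl
    simp only [Option.some.injEq, Prod.mk.injEq] at ha
    rw [← ha.2]
    have h1 : (1 : Ordinal.{u}) < ω := by simp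
    exact ⟨(Order.lt_add_one_iff.2 le_rfl).trans_le le_self_add, by gcongr⟩

theorem loader_length_le (k : ℕ) (D : Data.{u}) :
    (loader κ k D).length ≤ Cardinal.lift.{u + 1} κ := by
  have h : {s : Ordinal.{u} | (loader κ k D).table s ≠ none} ⊆ Set.Iio κ.ord := fun s hs => by
    by_contra h
    exact hs (if_neg h)
  refine (Cardinal.mk_le_mk_of_subset h).trans_eq ?_
  rw [Cardinal.mk_Iio_ordinal, Cardinal.card_ord]

theorem natCast_lt_ord (hκ : ℵ₀ ≤ κ) (n : ℕ) : (n : Ordinal.{u}) < κ.ord :=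
  (Ordinal.natCast_lt_omega0 n).trans_le (by rwa [← Cardinal.ord_aleph0, Cardinal.ord_le_ord])

theorem loader_fits (hN : ℵ₀ ≤ N) (k : ℕ) (D : Data.{u}) : (loader κ k D).Fits N := by
  intro s l hl
  simp only [loader] at hl
  split_ifs at hl
  simp only [Option.some.injEq] at hl
  subst hl
  refine ⟨by have := natCast_lt_ord hN 0; rwa [Nat.cast_zero] at this, fun b a t ha => ?_⟩
  simp only [Option.some.injEq, Prod.mk.injEq] at ha
  rw [← ha.1, loaderAction]
  split_ifs
  · exact natCast_lt_ord hN _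
  · exact natCast_lt_ord hN _

/-- The snapshot of the loading program at time `τ`. -/
structure LoaderInv (k : ℕ) (D : Data.{u}) (τ : Ordinal.{u}) (c : Config.{u}) : Prop where
  state : c.state = τ
  head : ∀ i : ℕ, i < k → Paced (2 * k) (2 * i + 1) (c.head (.output i)) τ
  out : ∀ β ζ, c.mem (.output β) ζ = true ↔
    ∃ i : ℕ, (i < k ∧ β = i ∧ D i ζ = true) ∧ tick (2 * k) ζ (2 * i) < τ

theorem LoaderInv.step {k : ℕ} (hk : 0 < k) {D : Data.{u}} {τ : Ordinal.{u}} {c : Config.{u}}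
    (hκ : ℵ₀ ≤ κ) (hN : κ ≤ N) (h : LoaderInv k D τ c) (hτ : τ < κ.ord) :
    LoaderInv k D (τ + 1) ((loader κ k D).step N c) := by
  obtain ⟨α, r, hr, rfl⟩ := exists_eq_tick (c := 2 * k) (by omega) τ
  have hα : α + 1 < N.ord := ((Cardinal.isSuccLimit_ord hκ).add_one_lt
    ((tick_lt_ord hκ (by omega) _).1 hτ)).trans_le (Cardinal.ord_le_ord.2 hN)
  rw [Program.step_of_instr (a := loaderAction k D (tick (2 * k) α r)) (t := tick (2 * k) α r + 1)
    (by rw [h.state]; exact if_pos hτ) rfl, loaderAction_tick D α hr]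
  obtain ⟨j, rfl | rfl⟩ : ∃ j, r = 2 * j ∨ r = 2 * j + 1 := ⟨r / 2, by omega⟩
  · have hj : c.head (.output j) = α := (h.head j (by omega)).eq hr (by omega) (by omega)
    rw [if_pos (by omega), show 2 * j / 2 = j by omega]
    refine ⟨rfl, fun i hi => (h.head i hi).stay hr (by omega) (by omega), fun β ζ => ?_⟩
    simp only [Config.act, Config.write, hj]
    have key : (∃ i : ℕ, (i < k ∧ β = i ∧ D i ζ = true) ∧
          tick (2 * k) ζ (2 * i) < tick (2 * k) α (2 * j) + 1) ↔
        c.mem (.output β) ζ = true ∨ (β = j ∧ ζ = α ∧ D j α = true) := by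
      rw [h.out]
      constructor
      · rintro ⟨i, ⟨hi, hβ, hD⟩, ht⟩
        rw [tick_lt_tick_add_one (by omega) hr] at ht
        rcases ht with ht | ⟨rfl, ht⟩
        · exact Or.inl ⟨i, ⟨hi, hβ, hD⟩, ht⟩
        · obtain rfl : i = j := by omega
          exact Or.inr ⟨hβ, rfl, hD⟩
      · rintro (⟨i, hi, ht⟩ | ⟨rfl, rfl, hD⟩)
        · exact ⟨i, hi, ht.trans (Order.lt_add_one_iff.2 le_rfl)⟩
        · exact ⟨j, ⟨by omega, rfl, hD⟩, Order.lt_add_one_iff.2 le_rfl⟩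
    have hfalse : c.mem (.output j) α = false := by
      rw [Bool.eq_false_iff, Ne, h.out]
      rintro ⟨i, ⟨hi, hij, -⟩, ht⟩
      obtain rfl : j = i := by exact_mod_cast hij
      exact ht.false
    rw [key]
    by_cases hβ : β = j
    · subst hβ
      by_cases hζ : ζ = α
      · subst hζ
        simp [hfalse]
      · simp [hζ]
    · simp [hβ]
  · have hj : c.head (.output j) = α := (h.head j (by omega)).eq hr (by omega) (by omega)
    rw [if_neg (by omega), show (2 * j + 1) / 2 = j by omega]
    simp only [Config.act, hj, hα, if_true, Config.moveTo]
    refine ⟨rfl, fun i hi => ?_, fun β ζ => ?_⟩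
    · by_cases hij : i = j
      · subst hij
        have := (h.head i hi).move hr
        simpa [hj] using this
      · have := (h.head i hi).stay hr (by omega) (by omega)
        simpa [hij] using this
    · rw [h.out]
      refine exists_congr fun i => and_congr_right fun hi => ?_
      rw [tick_lt_tick_add_one (by omega) hr]
      exact (or_iff_left fun h => by omega).symm

theorem LoaderInv.run {k : ℕ} (hk : 0 < k) (D E : Data.{u}) (hκ : ℵ₀ ≤ κ) (hN : κ ≤ N)
    {τ : Ordinal.{u}} (hτ : τ ≤ κ.ord) :
    LoaderInv k D τ ((loader κ k D).run N E τ) := by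
  induction τ using Ordinal.limitRecOn with
  | zero =>
    rw [Program.run_zero]
    exact ⟨rfl, fun _ _ => Paced.zero _ _, by simp [Config.initial]⟩
  | add_one τ ih =>
    rw [Program.run_add_one]
    have hτ' : τ < κ.ord := (Order.lt_add_one_iff.2 le_rfl).trans_le hτ
    exact (ih hτ'.le).step hk hκ hN hτ'
  | limit o ho ih =>
    replace ih := fun τ (h : τ < o) => ih τ h (h.le.trans hτ)
    refine ⟨?_, fun i hi => Paced.limit ho fun τ h => (ih τ h).head i hi, fun β ζ => ?_⟩
    · rw [Program.run_limit _ _ ho]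
      refine eq_of_forall_lt_iff fun α => ?_
      exact lt_limsupOrd_iff ho (g := id) (fun τ h α => by rw [(ih τ h).state]; rfl)
        (fun τ h => (ih τ h).state.le) α
    · rw [Program.run_limit _ _ ho]
      exact limsupBit_iff ho fun τ h => (ih τ h).out β ζ

theorem loader_result {k : ℕ} (hk : 0 < k) (D E : Data.{u}) (hκ : ℵ₀ ≤ κ) (hN : κ ≤ N)
    (β ζ : Ordinal.{u}) :
    (loader κ k D).result N κ E β ζ = true ↔
      ∃ i : ℕ, (i < k ∧ β = i ∧ D i ζ = true) ∧ ζ < κ.ord := by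
  rw [Program.result, (LoaderInv.run hk D E hκ hN le_rfl).out]
  simp only [tick_lt_ord hκ (c := 2 * k) (by omega)]

/-! ### Renumbering the input sets of a program -/

/-- Input set `β` becomes input set `m + β`. -/
def RegSet.shift (m : ℕ) : RegSet.{u} → RegSet.{u}
  | .input β => .input (m + β)
  | .work β => .work β
  | .output β => .output β

theorem RegSet.shift_injective (m : ℕ) : Function.Injective (RegSet.shift.{u} m) := by
  intro R S h
  cases R <;> cases S <;> simp_all [RegSet.shift]

def Source.shift (m : ℕ) : Source.{u} → Source.{u}
  | .input β => .input (m + β)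
  | .work β => .work β

theorem Source.regSet_shift (m : ℕ) (S : Source.{u}) : (S.shift m).regSet = S.regSet.shift m := by
  cases S <;> rfl

def Action.shift (m : ℕ) : Action.{u} → Action.{u}
  | .nop => .nop
  | .writeWork β b => .writeWork β b
  | .writeOutput β b => .writeOutput β b
  | .left R => .left (R.shift m)
  | .right R => .right (R.shift m)
  | .reset R => .reset (R.shift m)

def Entry.shift (m : ℕ) (l : Entry.{u}) : Entry.{u} where
  source := l.source.shift m
  instr b := (l.instr b).map fun p => (p.1.shift m, p.2)

theorem RegSet.index_shift_lt {m : ℕ} {R : RegSet.{u}} (h : R.index < (ℵ₀ : Cardinal.{u}).ord) :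
    (R.shift m).index < (ℵ₀ : Cardinal.{u}).ord := by
  cases R with
  | input β => exact isPrincipal_add_ord le_rfl (natCast_lt_ord le_rfl m) h
  | work β => exact h
  | output β => exact h

/-- The program `P` with input set `m + β` in the place of input set `β`. -/
noncomputable def FiniteProgram.shift (m : ℕ) (P : FiniteProgram.{u}) : FiniteProgram.{u} where
  table s := (P.table s).map (Entry.shift m)
  near := by
    intro s l b a t hl ha
    obtain ⟨l', hl', rfl⟩ := Option.map_eq_some_iff.1 hl
    obtain ⟨⟨a', t'⟩, ha', h⟩ := Option.map_eq_some_iff.1 ha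
    cases h
    exact P.near s l' b a' t' hl' ha'
  finite := by
    refine lt_of_eq_of_lt ?_ P.finite
    simp [Program.length]
  fits := by
    intro s l hl
    obtain ⟨l', hl', rfl⟩ := Option.map_eq_some_iff.1 hl
    obtain ⟨h1, h2⟩ := P.fits s l' hl'
    refine ⟨?_, fun b a t ha => ?_⟩
    · simpa only [Entry.shift, Source.regSet_shift] using RegSet.index_shift_lt h1
    · obtain ⟨⟨a', t'⟩, ha', h⟩ := Option.map_eq_some_iff.1 ha
      cases h
      have := h2 b a' t' ha'
      cases a' with
      | nop => exact this
      | writeWork β b => exact this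
      | writeOutput β b => exact this
      | left R => exact RegSet.index_shift_lt this
      | right R => exact RegSet.index_shift_lt this
      | reset R => exact RegSet.index_shift_lt this

/-- The snapshot `c'` agrees with `c` after renumbering of the input sets. -/
structure Config.ShiftOf (m : ℕ) (c' c : Config.{u}) : Prop where
  state : c'.state = c.state
  head : ∀ R, c'.head (R.shift m) = c.head R
  mem : ∀ R, c'.mem (R.shift m) = c.mem R

theorem Config.ShiftOf.write {m : ℕ} {c' c : Config.{u}} (h : c'.ShiftOf m c) (R : RegSet.{u})
    (b : Bool) : (c'.write (R.shift m) b).ShiftOf m (c.write R b) := by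
  refine ⟨h.state, h.head, fun S => ?_⟩
  simp only [Config.write, h.head, h.mem]
  by_cases hS : S = R
  · subst hS; simp
  · simp [hS, (RegSet.shift_injective m).ne hS, h.mem]

theorem Config.ShiftOf.moveTo {m : ℕ} {c' c : Config.{u}} (h : c'.ShiftOf m c) (R : RegSet.{u})
    (α : Ordinal.{u}) : (c'.moveTo (R.shift m) α).ShiftOf m (c.moveTo R α) := by
  refine ⟨h.state, fun S => ?_, h.mem⟩
  simp only [Config.moveTo]
  by_cases hS : S = R
  · subst hS; simp
  · simp [hS, (RegSet.shift_injective m).ne hS, h.head]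

theorem Config.ShiftOf.act {m : ℕ} {c' c : Config.{u}} (h : c'.ShiftOf m c) (hN : κ ≤ N)
    (hc : ∀ R, c.head R + 1 < κ.ord) (a : Action.{u}) :
    (c'.act N (a.shift m)).ShiftOf m (c.act κ a) := by
  cases a with
  | nop => exact h
  | writeWork β b => exact h.write (.work β) b
  | writeOutput β b => exact h.write (.output β) b
  | left R => simpa only [Action.shift, Config.act, h.head] using h.moveTo R _
  | right R =>
    simpa only [Action.shift, Config.act, h.head, hc R, (hc R).trans_le (Cardinal.ord_le_ord.2 hN),
      if_true] using h.moveTo R _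
  | reset R => exact h.moveTo R 0

/-- Within `o(κ)` steps no head reaches register `o(κ)`, so that a computation with `N` registers
in each set goes through the same snapshots as the one with `κ` registers. -/
theorem FiniteProgram.shift_run (P : FiniteProgram.{u}) (m : ℕ) (D : Data.{u}) (hκ : ℵ₀ ≤ κ)
    (hN : κ ≤ N) {τ : Ordinal.{u}} (hτ : τ ≤ κ.ord) :
    ((P.shift m).run N D τ).ShiftOf m (P.run κ (fun β => D (m + β)) τ) := by
  induction τ using Ordinal.limitRecOn with
  | zero =>
    rw [Program.run_zero, Program.run_zero]
    exact ⟨rfl, fun R => rfl, fun R => by cases R <;> rfl⟩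
  | add_one τ ih =>
    have hτ' : τ < κ.ord := (Order.lt_add_one_iff.2 le_rfl).trans_le hτ
    have hc : ∀ R, (P.run κ (fun β => D (m + β)) τ).head R + 1 < κ.ord := fun R =>
      (Cardinal.isSuccLimit_ord hκ).add_one_lt ((P.run_head_le _ τ R).trans_lt hτ')
    specialize ih hτ'.le
    rw [Program.run_add_one, Program.run_add_one]
    generalize P.run κ (fun β => D (m + β)) τ = c at ih hc
    generalize (P.shift m).run N D τ = c' at ih
    simp only [Program.step, FiniteProgram.shift, ih.state]
    cases hl : P.table c.state with
    | none => exact ih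
    | some l =>
      simp only [Option.map_some, Entry.shift, Source.regSet_shift, ih.head, ih.mem]
      cases ha : l.instr (c.mem l.source.regSet (c.head l.source.regSet)) with
      | none => exact ih
      | some p =>
        have := ih.act hN hc p.1
        exact ⟨rfl, this.head, this.mem⟩
  | limit o ho ih =>
    replace ih := fun τ (h : τ < o) => ih τ h (h.le.trans hτ)
    rw [Program.run_limit _ _ ho, Program.run_limit _ _ ho]
    refine ⟨?_, fun R => ?_, fun R => funext fun ζ => ?_⟩
    · exact congrArg (limsupOrd o) (funext₂ fun τ h => (ih τ h).state)
    · exact congrArg (limsupOrd o) (funext₂ fun τ h => (ih τ h).head R)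
    · exact congrArg (limsupBit o) (funext₂ fun τ h => congrFun ((ih τ h).mem R) ζ)

theorem FiniteProgram.shift_result (P : FiniteProgram.{u}) (m : ℕ) (D : Data.{u}) (hκ : ℵ₀ ≤ κ)
    (hN : κ ≤ N) (β : Ordinal.{u}) :
    (P.shift m).result N κ D β = P.result κ κ (fun β => D (m + β)) β :=
  (P.shift_run m D hκ hN le_rfl).mem (.output β)

/-! ### Carrying out an evaluation -/

/-- The stage of a parallel hypercomputer that carries out a step of an evaluation. -/
noncomputable def EvalStep.toStage (hκ : ℵ₀ ≤ κ) (hN : κ ≤ N) (asg : Idx N → Assignment κ)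
    (E : EvalStep.{u}) : Stage.{u} N κ where
  prog _ := E.prog.toProgram
  length_le _ := E.prog.finite.le.trans (by simpa using hκ)
  fits _ := by
    have hord : (ℵ₀ : Cardinal.{u}).ord ≤ N.ord := Cardinal.ord_le_ord.2 (hκ.trans hN)
    intro s l hl
    obtain ⟨h1, h2⟩ := E.prog.fits s l hl
    refine ⟨h1.trans_le hord, fun b a t ha => ?_⟩
    have := h2 b a t ha
    cases a with
    | nop => exact this
    | writeWork β b => exact this.trans_le hord
    | writeOutput β b => exact this.trans_le hord
    | left R => exact this.trans_le hord
    | right R => exact this.trans_le hord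
    | reset R => exact this.trans_le hord
  dst := E.dst
  dst_lt := natCast_lt_ord (hκ.trans hN) _
  start := E.comb.start
  sources := E.comb.sources asg

theorem Stage.combine_eq_true_iff {p : Cardinal.{u}} (S : Stage.{u} N p) (out : Idx N → Data.{u})
    (γ : Idx N) (α : Ordinal.{u}) :
    S.combine out γ α = true ↔
      if S.start then ∀ δ ∈ S.sources γ, out δ 0 α = true
      else ∃ δ ∈ S.sources γ, out δ 0 α = true := by
  unfold Stage.combine
  by_cases h : ∃ δ ∈ S.sources γ, out δ 0 α ≠ S.start
  · rw [if_pos h]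
    cases hs : S.start <;> simpa [hs] using h
  · rw [if_neg h]
    cases hs : S.start <;> simpa [hs] using h

/-- The contents of the registers after the steps of an evaluation. -/
noncomputable def carryOut (hκ : ℵ₀ ≤ κ) (hN : κ ≤ N) (asg : Idx N → Assignment κ)
    (steps : List EvalStep.{u}) (store : Idx N → Data.{u}) : Idx N → Data.{u} :=
  steps.foldl (fun store E => (E.toStage hκ hN asg).exec κ store) store

section carryOut

variable (hκ : ℵ₀ ≤ κ) (hN : κ ≤ N) (asg : Idx N → Assignment κ)

theorem carryOut_append (l₁ l₂ : List EvalStep.{u}) (store : Idx N → Data.{u}) :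
    carryOut hκ hN asg (l₁ ++ l₂) store =
      carryOut hκ hN asg l₂ (carryOut hκ hN asg l₁ store) :=
  List.foldl_append ..

theorem carryOut_singleton_of_ne (E : EvalStep.{u}) (store : Idx N → Data.{u}) (γ : Idx N)
    {β : Ordinal.{u}} (hβ : β ≠ E.dst) : carryOut hκ hN asg [E] store γ β = store γ β := by
  simp only [carryOut, List.foldl_cons, List.foldl_nil, Stage.exec]
  exact Function.update_of_ne hβ _ _

theorem carryOut_singleton_dst (E : EvalStep.{u}) (store : Idx N → Data.{u}) (γ : Idx N)
    (α : Ordinal.{u}) :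
    carryOut hκ hN asg [E] store γ E.dst α = true ↔
      if E.comb.start then
        ∀ δ ∈ E.comb.sources asg γ, E.prog.result N κ (store δ) 0 α = true
      else ∃ δ ∈ E.comb.sources asg γ, E.prog.result N κ (store δ) 0 α = true := by
  have h : carryOut hκ hN asg [E] store γ E.dst = (E.toStage hκ hN asg).combine
      (fun δ => E.prog.result N κ (store δ)) γ := by
    simp only [carryOut, List.foldl_cons, List.foldl_nil, Stage.exec]
    exact Function.update_self _ _ _
  rw [h]
  exact Stage.combine_eq_true_iff ..

/-- All the sets of registers from `m` on, and possibly some others, are empty. -/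
def EmptyFrom (m : ℕ) (store : Idx N → Data.{u}) : Prop :=
  ∀ γ β, (m : Ordinal.{u}) ≤ β → store γ β = fun _ => false

/-- The sets of registers below `m` are the same in both stores. -/
def AgreeBelow (m : ℕ) (store' store : Idx N → Data.{u}) : Prop :=
  ∀ γ β, β < (m : Ordinal.{u}) → store' γ β = store γ β

variable {asg} {store store' store'' : Idx N → Data.{u}} {m m' : ℕ}

theorem AgreeBelow.trans (h : AgreeBelow m' store'' store') (h' : AgreeBelow m store' store)
    (hm : m ≤ m') : AgreeBelow m store'' store := fun γ β hβ =>
  (h γ β (hβ.trans_le (by exact_mod_cast hm))).trans (h' γ β hβ)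

theorem agreeBelow_carryOut_singleton (E : EvalStep.{u}) (store : Idx N → Data.{u}) :
    AgreeBelow E.dst (carryOut hκ hN asg [E] store) store := fun γ _ hβ =>
  carryOut_singleton_of_ne hκ hN asg E store γ hβ.ne

theorem EmptyFrom.carryOut_singleton {E : EvalStep.{u}} (h : EmptyFrom E.dst store) :
    EmptyFrom (E.dst + 1) (carryOut hκ hN asg [E] store) := by
  intro γ β hβ
  have : (E.dst : Ordinal.{u}) < β := lt_of_lt_of_le (by exact_mod_cast Nat.lt_succ_self _) hβ
  rw [carryOut_singleton_of_ne hκ hN asg E store γ this.ne', h γ β this.le]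

end carryOut

/-! ### Properties of assignments that a finite evaluation computes -/

/-- Machine `γ` holds the values of the variables with index `< n` under the assignment `asg γ`, and
the sets of registers from `m` on are free. -/
structure Ready (n m : ℕ) (asg : Idx N → Assignment κ) (store : Idx N → Data.{u}) : Prop where
  seq : ∀ γ, ∀ i < n, store γ (2 * i : ℕ) = ((asg γ).1 i).tape
  bit : ∀ γ, ∀ j < n, store γ (2 * j + 1 : ℕ) 0 = true ↔ (asg γ).1 0 ∈ (asg γ).2 j
  empty : EmptyFrom m store

theorem Ready.of_agreeBelow {n m m' : ℕ} {asg : Idx N → Assignment κ}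
    {store store' : Idx N → Data.{u}} (h : Ready n m asg store) (hm : 2 * n ≤ m)
    (ha : AgreeBelow m store' store) (he : EmptyFrom m' store') : Ready n m' asg store' where
  seq γ i hi := by
    rw [ha γ _ (by exact_mod_cast (by omega : 2 * i < m))]
    exact h.seq γ i hi
  bit γ j hj := by
    rw [ha γ _ (by exact_mod_cast (by omega : 2 * j + 1 < m))]
    exact h.bit γ j hj
  empty := he

/-- The machines work on all the values of each variable `v_i`. -/
def SeqClosed (asg : Idx N → Assignment κ) : Prop :=
  ∀ γ i x, ∃ δ, asg δ = (Function.update (asg γ).1 i x, (asg γ).2)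

/-- The machines work on all the values of each variable `V_j`. -/
def SetClosed (asg : Idx N → Assignment κ) : Prop :=
  ∀ γ j X, ∃ δ, asg δ = ((asg γ).1, Function.update (asg γ).2 j X)

/-- The truth value of `T` can be computed by a finite evaluation that uses only the free sets of
registers from `m` on: it ends in register `0` of some set `a`, and the sets from `m'` on are still
free. The assignments have to be closed under changes of the variables `V_j` unless `fo`. -/
def Computable (fo : Prop) (T : ∀ κ : Cardinal.{u}, Assignment κ → Prop) : Prop :=
  ∃ n₀ : ℕ, ∀ n, n₀ ≤ n → ∀ m, 2 * n ≤ m → ∃ (steps : List EvalStep.{u}) (a m' : ℕ),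
    m ≤ a ∧ a < m' ∧
    ∀ {κ N : Cardinal.{u}} (hκ : ℵ₀ ≤ κ) (hN : κ ≤ N) (asg : Idx N → Assignment κ),
      SeqClosed asg → (fo ∨ SetClosed asg) → ∀ store, Ready n m asg store →
        AgreeBelow m (carryOut hκ hN asg steps store) store ∧
        EmptyFrom m' (carryOut hκ hN asg steps store) ∧
        ∀ γ, carryOut hκ hN asg steps store γ a 0 = true ↔ T κ (asg γ)

variable {fo fo₁ fo₂ : Prop} {T T₁ T₂ : ∀ κ : Cardinal.{u}, Assignment κ → Prop}

/-- An evaluation with a single step. -/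
theorem Computable.of_single {n₀ : ℕ} (E : ℕ → EvalStep.{u}) (hE : ∀ m, (E m).dst = m)
    (h : ∀ n, n₀ ≤ n → ∀ m, 2 * n ≤ m →
      ∀ {κ N : Cardinal.{u}} (hκ : ℵ₀ ≤ κ) (hN : κ ≤ N) (asg : Idx N → Assignment κ)
        (store : Idx N → Data.{u}), Ready n m asg store →
        ∀ γ, carryOut hκ hN asg [E m] store γ m 0 = true ↔ T κ (asg γ)) : Computable fo T := by
  refine ⟨n₀, fun n hn m hm => ⟨[E m], m, m + 1, le_rfl, Nat.lt_succ_self m, ?_⟩⟩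
  intro κ N hκ hN asg _ _ store hr
  have h1 := agreeBelow_carryOut_singleton hκ hN (asg := asg) (E m) store
  have h2 : EmptyFrom ((E m).dst + 1) (carryOut hκ hN asg [E m] store) :=
    EmptyFrom.carryOut_singleton hκ hN (by rw [hE]; exact hr.empty)
  rw [hE] at h1 h2
  exact ⟨h1, h2, h n hn m hm hκ hN asg store hr⟩

/-- The step in which the machines apply `f` to the contents of the sets of registers `a` and `b`,
register by register, and the results are combined according to `comb`. -/
noncomputable def gateStep (a b : ℕ) (f : Bool → Bool → Bool) (comb : Combination) (dst : ℕ) :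
    EvalStep.{u} :=
  ⟨sweep a b f true, comb, dst⟩

theorem carryOut_gateStep {a b : ℕ} (hab : a ≠ b) (f : Bool → Bool → Bool) (comb : Combination)
    (dst : ℕ) (hκ : ℵ₀ ≤ κ) (hN : κ ≤ N) (asg : Idx N → Assignment κ) (store : Idx N → Data.{u})
    (γ : Idx N) :
    carryOut hκ hN asg [gateStep a b f comb dst] store γ dst 0 = true ↔
      if comb.start then ∀ δ ∈ comb.sources asg γ, f (store δ a 0) (store δ b 0) = true
      else ∃ δ ∈ comb.sources asg γ, f (store δ a 0) (store δ b 0) = true := by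
  have h0 : (0 : Ordinal.{u}) < κ.ord := by simpa using natCast_lt_ord hκ 0
  refine (carryOut_singleton_dst hκ hN asg (gateStep a b f comb dst) store γ 0).trans ?_
  simp only [gateStep, sweep_result hab f true _ hκ hN, if_true]
  simp [h0]

theorem computable_mem_zero (j : ℕ) : Computable.{u} fo fun _ s => s.1 0 ∈ s.2 j := by
  refine Computable.of_single (n₀ := j + 1) (fun m => gateStep (2 * j + 1) m (fun x _ => x) .copy m)
    (fun _ => rfl) fun n hn m hm κ N hκ hN asg store hr γ => ?_
  rw [carryOut_gateStep (by omega), ← hr.bit γ j (by omega)]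
  simp [Combination.start, Combination.sources]

theorem BinSeq.tape_apply (x : BinSeq κ) {α : Ordinal.{u}} (hα : α < κ.ord) :
    x.tape α = x ⟨α, hα⟩ := dif_pos hα

theorem BinSeq.tape_of_not_lt (x : BinSeq κ) {α : Ordinal.{u}} (hα : ¬ α < κ.ord) :
    x.tape α = false := dif_neg hα

theorem computable_ne {i j : ℕ} (hij : i ≠ j) : Computable.{u} fo fun _ s => s.1 i ≠ s.1 j := by
  refine Computable.of_single (n₀ := max i j + 1)
    (fun m => ⟨sweep (2 * i) (2 * j) (fun x y => x != y) false, .copy, m⟩)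
    (fun _ => rfl) fun n hn m hm κ N hκ hN asg store hr γ => ?_
  refine (carryOut_singleton_dst hκ hN asg _ store γ 0).trans ?_
  have h1 : 2 * i ≠ 2 * j := by omega
  simp only [sweep_result h1 _ _ _ hκ hN, Combination.start, Combination.sources, if_true,
    Set.mem_singleton_iff, forall_eq, hr.seq γ i (by omega), hr.seq γ j (by omega)]
  simp only [bne_iff_ne, Ne, funext_iff, not_forall]
  constructor
  · rintro ⟨α, hα, -, h⟩
    rw [BinSeq.tape_apply _ hα, BinSeq.tape_apply _ hα] at h
    exact ⟨⟨α, hα⟩, h⟩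
  · rintro ⟨⟨α, hα⟩, h⟩
    refine ⟨α, hα, by simp, ?_⟩
    rwa [BinSeq.tape_apply _ hα, BinSeq.tape_apply _ hα]

/-- The second evaluation starts where the free sets of registers of the first one end, so that the
truth values of `T₁` and `T₂` are in different sets, which the two heads of a sweep can read. -/
theorem Computable.gate (f : Bool → Bool → Bool) (h₁ : Computable fo₁ T₁) (h₂ : Computable fo₂ T₂)
    (hfo₁ : fo → fo₁) (hfo₂ : fo → fo₂)
    (hT : ∀ κ s x y, (x = true ↔ T₁ κ s) → (y = true ↔ T₂ κ s) → (f x y = true ↔ T κ s)) :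
    Computable fo T := by
  obtain ⟨n₁, h₁⟩ := h₁
  obtain ⟨n₂, h₂⟩ := h₂
  refine ⟨max n₁ n₂, fun n hn m hm => ?_⟩
  obtain ⟨s₁, a₁, m₁, ha₁, hm₁, h₁⟩ := h₁ n (by omega) m hm
  obtain ⟨s₂, a₂, m₂, ha₂, hm₂, h₂⟩ := h₂ n (by omega) m₁ (by omega)
  refine ⟨s₁ ++ (s₂ ++ [gateStep a₁ a₂ f .copy m₂]), m₂, m₂ + 1, by omega, by omega, ?_⟩
  intro κ N hκ hN asg hseq hset store hr
  rw [carryOut_append, carryOut_append]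
  obtain ⟨hA₁, hE₁, hv₁⟩ := h₁ hκ hN asg hseq (hset.imp_left hfo₁) store hr
  obtain ⟨hA₂, hE₂, hv₂⟩ := h₂ hκ hN asg hseq (hset.imp_left hfo₂) _
    (hr.of_agreeBelow hm hA₁ hE₁)
  refine ⟨(agreeBelow_carryOut_singleton hκ hN _ _).trans (hA₂.trans hA₁ (by omega))
    (by simp only [gateStep]; omega),
    EmptyFrom.carryOut_singleton hκ hN (E := gateStep a₁ a₂ f .copy m₂) hE₂, fun γ => ?_⟩
  rw [carryOut_gateStep (by omega)]
  simp only [Combination.start, Combination.sources, if_true, Set.mem_singleton_iff, forall_eq]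
  refine hT κ (asg γ) _ _ ?_ (hv₂ γ)
  rw [hA₂ γ a₁ (by exact_mod_cast hm₁)]
  exact hv₁ γ

/-- One more step applies `f` to the truth values of `T₁` and combines them over the machines. The
sweep needs a second set of registers, for which the empty set `m₁` serves. -/
theorem Computable.combine (f : Bool → Bool) (comb : Combination) (h₁ : Computable fo₁ T₁)
    (hfo₁ : fo → fo₁)
    (hT : ∀ {κ N : Cardinal.{u}} (asg : Idx N → Assignment κ), SeqClosed asg →
      (fo ∨ SetClosed asg) → ∀ out : Idx N → Bool, (∀ δ, out δ = true ↔ T₁ κ (asg δ)) → ∀ γ,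
        ((if comb.start then ∀ δ ∈ comb.sources asg γ, f (out δ) = true
          else ∃ δ ∈ comb.sources asg γ, f (out δ) = true) ↔ T κ (asg γ))) :
    Computable fo T := by
  obtain ⟨n₁, h₁⟩ := h₁
  refine ⟨n₁, fun n hn m hm => ?_⟩
  obtain ⟨s₁, a₁, m₁, ha₁, hm₁, h₁⟩ := h₁ n hn m hm
  refine ⟨s₁ ++ [gateStep a₁ m₁ (fun x _ => f x) comb m₁], m₁, m₁ + 1, by omega, by omega, ?_⟩
  intro κ N hκ hN asg hseq hset store hr
  rw [carryOut_append]
  obtain ⟨hA₁, hE₁, hv₁⟩ := h₁ hκ hN asg hseq (hset.imp_left hfo₁) store hr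
  refine ⟨(agreeBelow_carryOut_singleton hκ hN _ _).trans hA₁ (by simp only [gateStep]; omega),
    EmptyFrom.carryOut_singleton hκ hN (E := gateStep a₁ m₁ (fun x _ => f x) comb m₁) hE₁,
    fun γ => ?_⟩
  rw [carryOut_gateStep (by omega)]
  exact hT asg hseq hset _ hv₁ γ

theorem Computable.not (h : Computable fo T) : Computable fo fun κ s => ¬ T κ s := by
  refine h.combine (fun x => !x) .copy id fun asg _ _ out hout γ => ?_
  simp [Combination.start, Combination.sources, ← hout]

theorem Computable.allSeq (h : Computable fo T) (i : ℕ) :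
    Computable fo fun κ s => ∀ x : BinSeq κ, T κ (Function.update s.1 i x, s.2) := by
  refine h.combine id (.overSeq true i) id fun asg hseq _ out hout γ => ?_
  simp only [Combination.start, Combination.sources, if_true, id, hout, Set.mem_ofPred_eq]
  constructor
  · intro h x
    obtain ⟨δ, hδ⟩ := hseq γ i x
    rw [← hδ]
    exact h δ ⟨x, hδ⟩
  · rintro h δ ⟨x, hδ⟩
    rw [hδ]
    exact h x

theorem Computable.exSeq (h : Computable fo T) (i : ℕ) :
    Computable fo fun κ s => ∃ x : BinSeq κ, T κ (Function.update s.1 i x, s.2) := by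
  refine h.combine id (.overSeq false i) id fun asg hseq _ out hout γ => ?_
  simp only [Combination.start, Combination.sources, id, hout, Set.mem_ofPred_eq]
  constructor
  · rintro ⟨δ, ⟨x, hδ⟩, h⟩
    exact ⟨x, hδ ▸ h⟩
  · rintro ⟨x, h⟩
    obtain ⟨δ, hδ⟩ := hseq γ i x
    exact ⟨δ, ⟨x, hδ⟩, hδ ▸ h⟩

theorem Computable.allSet (h : Computable fo T) (j : ℕ) :
    Computable False fun κ s => ∀ X : Set (BinSeq κ), T κ (s.1, Function.update s.2 j X) := by
  refine h.combine id (.overSet true j) False.elim fun asg _ hset out hout γ => ?_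
  replace hset := hset.resolve_left id
  simp only [Combination.start, Combination.sources, if_true, id, hout, Set.mem_ofPred_eq]
  constructor
  · intro h x
    obtain ⟨δ, hδ⟩ := hset γ j x
    rw [← hδ]
    exact h δ ⟨x, hδ⟩
  · rintro h δ ⟨x, hδ⟩
    rw [hδ]
    exact h x

theorem Computable.exSet (h : Computable fo T) (j : ℕ) :
    Computable False fun κ s => ∃ X : Set (BinSeq κ), T κ (s.1, Function.update s.2 j X) := by
  refine h.combine id (.overSet false j) False.elim fun asg _ hset out hout γ => ?_
  replace hset := hset.resolve_left id
  simp only [Combination.start, Combination.sources, id, hout, Set.mem_ofPred_eq]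
  constructor
  · rintro ⟨δ, ⟨x, hδ⟩, h⟩
    exact ⟨x, hδ ▸ h⟩
  · rintro ⟨x, h⟩
    obtain ⟨δ, hδ⟩ := hset γ j x
    exact ⟨δ, ⟨x, hδ⟩, hδ ▸ h⟩

theorem computable_eq (i j : ℕ) : Computable.{u} fo fun _ s => s.1 i = s.1 j := by
  by_cases hij : i = j
  · subst hij
    -- The constant gate ignores its argument; any computable property would do.
    exact (computable_mem_zero (fo := fo) 0).combine (fun _ => true) .copy id
      fun asg _ _ out _ γ => by simp [Combination.start]
  · simpa using (computable_ne hij).not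

/-- The machines hold membership bits for `v_0` only. For another variable `v_i`, the bit is that of
a machine with `v_0 = v_i`. -/
theorem computable_mem (i j : ℕ) : Computable.{u} fo fun _ s => s.1 i ∈ s.2 j := by
  by_cases hi : i = 0
  · subst hi
    exact computable_mem_zero j
  · have h := ((computable_eq (fo := fo) 0 i).gate (fo := fo)
      (T := fun _ s => s.1 0 = s.1 i ∧ s.1 0 ∈ s.2 j) (fun x y => x && y)
      (computable_mem_zero (fo := fo) j) id id
      (fun κ s x y hx hy => by rw [Bool.and_eq_true, hx, hy])).exSeq 0
    simpa [hi] using h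

/-! ### Recursive relations -/

/-- The step that copies the value of `v_i` into the set of registers `dst`. -/
noncomputable def copyStep (i dst : ℕ) : EvalStep.{u} :=
  gateStep (2 * i) dst (fun x _ => x) .copy dst

theorem carryOut_copyStep {n m i : ℕ} (hκ : ℵ₀ ≤ κ) (hN : κ ≤ N) {asg : Idx N → Assignment κ}
    {store : Idx N → Data.{u}} (hr : Ready n m asg store) (hm : 2 * n ≤ m) (hi : i < n)
    (γ : Idx N) : carryOut hκ hN asg [copyStep i m] store γ m = ((asg γ).1 i).tape := by
  funext α
  rw [Bool.eq_iff_iff]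
  refine (carryOut_singleton_dst hκ hN asg (copyStep i m) store γ α).trans ?_
  have h1 : 2 * i ≠ m := by omega
  simp only [copyStep, gateStep, Combination.start, Combination.sources, if_true,
    Set.mem_singleton_iff, forall_eq, sweep_result h1 _ _ _ hκ hN, hr.seq γ i hi]
  constructor
  · rintro ⟨_, -, rfl, h⟩
    exact h
  · intro h
    refine ⟨α, ?_, rfl, h⟩
    by_contra hα
    rw [BinSeq.tape_of_not_lt _ hα] at h
    exact absurd h (by simp)

theorem carryOut_copySteps {n m : ℕ} (hκ : ℵ₀ ≤ κ) (hN : κ ≤ N) {asg : Idx N → Assignment κ}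
    {store : Idx N → Data.{u}} (hr : Ready n m asg store) (hm : 2 * n ≤ m) {v : ℕ → ℕ}
    (hv : ∀ i, v i < n) (k : ℕ) :
    let store' := carryOut hκ hN asg ((List.range k).map fun i => copyStep (v i) (m + i)) store
    AgreeBelow m store' store ∧ EmptyFrom (m + k) store' ∧
      ∀ γ, ∀ i < k, store' γ (m + i : ℕ) = ((asg γ).1 (v i)).tape := by
  induction k with
  | zero => exact ⟨fun _ _ _ => rfl, hr.empty, fun _ _ h => absurd h (Nat.not_lt_zero _)⟩
  | succ k ih =>
    rw [List.range_succ, List.map_append, carryOut_append, List.map_singleton]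
    dsimp only at ih ⊢
    generalize carryOut hκ hN asg ((List.range k).map fun i => copyStep (v i) (m + i)) store =
      store' at ih ⊢
    obtain ⟨hA, hE, hv'⟩ := ih
    have hr' := hr.of_agreeBelow hm hA hE
    have hA' : AgreeBelow (m + k) _ store' :=
      agreeBelow_carryOut_singleton hκ hN (asg := asg) (copyStep (v k) (m + k)) store'
    refine ⟨hA'.trans hA (by omega),
      EmptyFrom.carryOut_singleton hκ hN (E := copyStep (v k) (m + k)) hE, fun γ i hi => ?_⟩
    rcases Nat.lt_succ_iff_lt_or_eq.1 hi with hi | rfl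
    · rw [hA' γ _ (by exact_mod_cast (by omega : m + i < m + k))]
      exact hv' γ i hi
    · exact carryOut_copyStep hκ hN hr' (by omega) (hv i) γ

theorem tuple_natCast {k : ℕ} (x : Fin k → BinSeq κ) (i : Fin k) :
    tuple x ((i : ℕ) : Ordinal.{u}) = (x i).tape := by
  funext α
  have h : ∃ i' : Fin k, ((i : ℕ) : Ordinal.{u}) = (i' : ℕ) := ⟨i, rfl⟩
  have h' : h.choose = i := by
    have := h.choose_spec
    exact (Fin.ext (by exact_mod_cast this)).symm
  rw [tuple, dif_pos h, h']

/-- The arguments are copied into consecutive free sets of registers. So each argument has a head of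
its own, even if variables are repeated, and the sets behind the arguments are empty. -/
theorem computable_rel (P : FiniteProgram.{u}) (k : ℕ) (v : Fin k → ℕ) :
    Computable.{u} fo fun κ s => P.Accepts κ fun i => s.1 (v i) := by
  refine ⟨Finset.univ.sup v + 1, fun n hn m hm => ?_⟩
  let w : ℕ → ℕ := fun i => if h : i < k then v ⟨i, h⟩ else 0
  have hw : ∀ i, w i < n := by
    intro i
    simp only [w]
    split_ifs with h
    · have := Finset.le_sup (f := v) (Finset.mem_univ ⟨i, h⟩)
      omega
    · omega
  refine ⟨(List.range k).map (fun i => copyStep (w i) (m + i)) ++ [⟨P.shift m, .copy, m + k⟩],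
    m + k, m + k + 1, by omega, by omega, ?_⟩
  intro κ N hκ hN asg _ _ store hr
  rw [carryOut_append]
  obtain ⟨hA, hE, hv⟩ := carryOut_copySteps hκ hN hr hm hw k
  refine ⟨(agreeBelow_carryOut_singleton hκ hN _ _).trans hA (by simp),
    EmptyFrom.carryOut_singleton hκ hN (E := ⟨P.shift m, .copy, m + k⟩) hE, fun γ => ?_⟩
  refine (carryOut_singleton_dst hκ hN asg ⟨P.shift m, .copy, m + k⟩ _ γ 0).trans ?_
  simp only [Combination.start, Combination.sources, if_true, Set.mem_singleton_iff, forall_eq,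
    P.shift_result m _ hκ hN, FiniteProgram.Accepts]
  rw [show (fun β => carryOut hκ hN asg ((List.range k).map fun i => copyStep (w i) (m + i)) store γ
    ((m : Ordinal.{u}) + β)) = tuple fun i => (asg γ).1 (v i) from ?_]
  funext β
  by_cases hβ : ∃ i : Fin k, β = (i : ℕ)
  · obtain ⟨i, rfl⟩ := hβ
    rw [tuple_natCast]
    have := hv γ i i.2
    simpa [w] using this
  · have h1 : (k : Ordinal.{u}) ≤ β := by
      by_contra! h
      obtain ⟨i, rfl⟩ := Ordinal.lt_omega0.1 (h.trans (Ordinal.natCast_lt_omega0 k))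
      exact hβ ⟨⟨i, by exact_mod_cast h⟩, rfl⟩
    rw [hE γ _ (by push_cast; gcongr)]
    funext α
    rw [tuple, dif_neg hβ]

/-! ### Evaluation of formulas -/

theorem Formula.computable (φ : Formula.{u}) :
    Computable φ.FirstOrder fun κ s => φ.Holds κ s := by
  induction φ with
  | rel P k v => exact computable_rel P k v
  | eq i j => exact computable_eq i j
  | mem i j => exact computable_mem i j
  | not φ ih => exact ih.not
  | and φ ψ ih₁ ih₂ =>
    exact ih₁.gate (fun x y => x && y) ih₂ And.left And.right fun κ s x y hx hy => by
      simp [Formula.Holds, ← hx, ← hy]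
  | or φ ψ ih₁ ih₂ =>
    exact ih₁.gate (fun x y => x || y) ih₂ And.left And.right fun κ s x y hx hy => by
      simp [Formula.Holds, ← hx, ← hy]
  | imp φ ψ ih₁ ih₂ =>
    exact ih₁.gate (fun x y => !x || y) ih₂ And.left And.right fun κ s x y hx hy => by
      cases x <;> simp [Formula.Holds, ← hx, ← hy]
  | iff φ ψ ih₁ ih₂ =>
    exact ih₁.gate (fun x y => x == y) ih₂ And.left And.right fun κ s x y hx hy => by
      cases x <;> cases y <;> simp [Formula.Holds, ← hx, ← hy]
  | all i φ ih => exact ih.allSeq i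
  | ex i φ ih => exact ih.exSeq i
  | allSet j φ ih => exact ih.allSet j
  | exSet j φ ih => exact ih.exSet j

theorem Assignment.data_two_mul {n i : ℕ} (hi : i < n) (s : Assignment κ) :
    s.data n (2 * i : ℕ) = (s.1 i).tape := by
  funext α
  have h : ∃ i' : ℕ, i' < n ∧ ((2 * i : ℕ) : Ordinal.{u}) = (2 * i' : ℕ) := ⟨i, hi, rfl⟩
  have h' : h.choose = i := by
    have : 2 * i = 2 * h.choose := by exact_mod_cast h.choose_spec.2
    omega
  rw [Assignment.data, dif_pos h, h']

theorem Assignment.data_two_mul_add_one {n j : ℕ} (hj : j < n) (s : Assignment κ)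
    (α : Ordinal.{u}) : s.data n (2 * j + 1 : ℕ) α = true ↔ α = 0 ∧ s.1 0 ∈ s.2 j := by
  have h0 : ¬ ∃ i' : ℕ, i' < n ∧ ((2 * j + 1 : ℕ) : Ordinal.{u}) = (2 * i' : ℕ) := by
    rintro ⟨i, -, h⟩
    have : 2 * j + 1 = 2 * i := by exact_mod_cast h
    omega
  have h : ∃ j' : ℕ, j' < n ∧ ((2 * j + 1 : ℕ) : Ordinal.{u}) = (2 * j' + 1 : ℕ) := ⟨j, hj, rfl⟩
  have h' : h.choose = j := by
    have : 2 * j + 1 = 2 * h.choose + 1 := by exact_mod_cast h.choose_spec.2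
    omega
  simp only [Assignment.data, dif_neg h0, dif_pos h, h', decide_eq_true_iff]

theorem Assignment.data_eq_false {n : ℕ} (s : Assignment κ) {β : Ordinal.{u}}
    (hβ : ∀ i < 2 * n, β ≠ (i : ℕ)) : s.data n β = fun _ => false := by
  funext α
  rw [Assignment.data, dif_neg, dif_neg]
  · rintro ⟨j, hj, h⟩
    exact hβ _ (by omega) h
  · rintro ⟨i, hi, h⟩
    exact hβ _ (by omega) h

theorem Assignment.lt_ord_of_data {n : ℕ} {s : Assignment κ} (hκ : ℵ₀ ≤ κ) {β α : Ordinal.{u}}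
    (h : s.data n β α = true) : α < κ.ord := by
  by_cases hβ : ∀ i < 2 * n, β ≠ (i : ℕ)
  · rw [s.data_eq_false hβ] at h
    exact absurd h (by simp)
  · push Not at hβ
    obtain ⟨i, hi, rfl⟩ := hβ
    obtain ⟨j, rfl | rfl⟩ : ∃ j, i = 2 * j ∨ i = 2 * j + 1 := ⟨i / 2, by omega⟩
    · rw [Assignment.data_two_mul (by omega)] at h
      by_contra hα
      rw [BinSeq.tape_of_not_lt _ hα] at h
      exact absurd h (by simp)
    · rw [((Assignment.data_two_mul_add_one (by omega) s α).1 h).1]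
      simpa using natCast_lt_ord hκ 0

theorem loader_result_data {n : ℕ} (hn : 0 < n) (hκ : ℵ₀ ≤ κ) (hN : κ ≤ N) (s : Assignment κ)
    (D : Data.{u}) : (loader κ (2 * n) (s.data n)).result N κ D = s.data n := by
  funext β α
  rw [Bool.eq_iff_iff, loader_result (by omega) _ _ hκ hN]
  constructor
  · rintro ⟨i, ⟨-, rfl, h⟩, -⟩
    exact h
  · intro h
    by_cases hβ : ∀ i < 2 * n, β ≠ (i : ℕ)
    · rw [s.data_eq_false hβ] at h
      exact absurd h (by simp)
    · push Not at hβ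
      obtain ⟨i, hi, rfl⟩ := hβ
      exact ⟨i, ⟨hi, rfl, h⟩, Assignment.lt_ord_of_data hκ h⟩

theorem ready_data (n : ℕ) (asg : Idx N → Assignment κ) :
    Ready n (2 * n) asg fun γ => (asg γ).data n where
  seq γ i hi := Assignment.data_two_mul hi _
  bit γ j hj := (Assignment.data_two_mul_add_one hj _ 0).trans (and_iff_right rfl)
  empty γ β hβ := by
    refine Assignment.data_eq_false _ fun i hi h => ?_
    rw [h] at hβ
    have : 2 * n ≤ i := by exact_mod_cast hβ
    omega

theorem Formula.exists_evaluation (φ : Formula.{u}) :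
    ∃ E : Evaluation.{u}, ∀ {κ N : Cardinal.{u}}, ℵ₀ ≤ κ → κ ≤ N →
      ∀ asg : Idx N → Assignment κ, SeqClosed asg → (φ.FirstOrder ∨ SetClosed asg) →
        E.Decides asg φ := by
  obtain ⟨n₀, h⟩ := φ.computable
  obtain ⟨steps, a, m', -, -, h⟩ := h (n₀ + 1) (by omega) _ le_rfl
  refine ⟨⟨n₀ + 1, steps, a⟩, fun {κ N} hκ hN asg hseq hset => ?_⟩
  let M : ParallelHypercomputer.{u} N κ κ :=
    { le_steps := le_rfl
      steps_le := hN
      load :=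
        { prog := fun γ => loader κ (2 * (n₀ + 1)) ((asg γ).data (n₀ + 1))
          length_le := fun γ => loader_length_le _ _
          fits := fun γ => loader_fits (hκ.trans hN) _ _ }
      stages := steps.map (EvalStep.toStage hκ hN asg) }
  have hM : M.loaded = fun γ => (asg γ).data (n₀ + 1) :=
    funext fun γ => loader_result_data (by omega) hκ hN _ _
  refine ⟨M, fun γ => congrFun hM γ, ?_, fun γ => ?_⟩
  · rw [List.forall₂_map_right_iff, List.forall₂_same]
    exact fun E _ => ⟨fun _ => rfl, rfl, rfl, rfl⟩
  · have hf : M.final = carryOut hκ hN asg steps fun γ => (asg γ).data (n₀ + 1) := by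
      rw [ParallelHypercomputer.final, hM, carryOut]
      exact List.foldl_map ..
    rw [hf]
    exact (h hκ hN asg hseq hset _ (ready_data _ asg)).2.2 γ

theorem seqClosed_of_equiv (e : Idx N ≃ (ℕ → BinSeq κ)) (X : ℕ → Set (BinSeq κ)) :
    SeqClosed fun γ => (e γ, X) := fun γ i x => ⟨e.symm (Function.update (e γ) i x), by simp⟩

end Hypercomputer

theorem theorem15 :
    (∀ φ : Formula.{u}, φ.FirstOrder → φ.MembershipFree →
      ∃ E : Evaluation.{u}, ∀ κ : Cardinal.{u}, ℵ₀ ≤ κ →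
        ∀ e : Idx ((2 : Cardinal.{u}) ^ κ) ≃ (ℕ → BinSeq κ),
          E.Decides (fun γ => (e γ, fun _ => ∅)) φ) ∧
    (∀ φ : Formula.{u}, φ.FirstOrder →
      ∃ E : Evaluation.{u}, ∀ κ : Cardinal.{u}, ℵ₀ ≤ κ →
        ∀ e : Idx ((2 : Cardinal.{u}) ^ κ) ≃ (ℕ → BinSeq κ),
          ∀ X : ℕ → Set (BinSeq κ), E.Decides (fun γ => (e γ, X)) φ) ∧
    (∀ φ : Formula.{u},
      ∃ E : Evaluation.{u}, ∀ κ : Cardinal.{u}, ℵ₀ ≤ κ →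
        ∀ e : Idx ((2 : Cardinal.{u}) ^ ((2 : Cardinal.{u}) ^ κ)) ≃ Assignment κ,
          E.Decides e φ) := by
  refine ⟨fun φ hφ _ => ?_, fun φ hφ => ?_, fun φ => ?_⟩ <;> obtain ⟨E, hE⟩ := φ.exists_evaluation
  · exact ⟨E, fun κ hκ e => hE hκ (Cardinal.cantor κ).le _ (seqClosed_of_equiv e _) (Or.inl hφ)⟩
  · exact ⟨E, fun κ hκ e X => hE hκ (Cardinal.cantor κ).le _ (seqClosed_of_equiv e X) (Or.inl hφ)⟩
  · exact ⟨E, fun κ hκ e => hE hκ ((Cardinal.cantor κ).le.trans (Cardinal.cantor _).le) _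
      (fun γ i x => ⟨e.symm _, e.apply_symm_apply _⟩)
      (Or.inr fun γ j X => ⟨e.symm _, e.apply_symm_apply _⟩)⟩
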